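/- **Setting and definitions.** Let $d\ge 1$, let $\|\cdot\|$ be the Euclidean norm on $\mathbb{R}^d$, and let $B_r$ be the closed ball of radius $r$ centered at $0$. Let $X\subseteq\mathbb{R}^d$ be closed and convex, let $f:\mathbb{R}^d\to\mathbb{R}$ be convex and minimized over $X$ at $x_*\in X$, let $x_0\in X$ and $\epsilon>0$. Let $\gamma_f$ be a Borel measurable selection of the subdifferential of $f$. For $r>0$ put $f_r(x)=\frac1{\mathrm{vol}(B_r)}\int_{B_r}f(x+u)\,du$. * $\hat L_r>0$ is a BVG$_{\max}$ constant of $f$ at radius $r$ if $\|\gamma_f(x+ru)-\gamma_f(x)\|\le\hat L_r$ for all $x\in\mathbb{R}^d$, $\|u\|\le1$. * $L_r$ is a BVG$_{\mathrm{avg}}$ constant of $f$ at radius $r$ if, for all $0<\rho\le r$ and all $x\in\mathbb{R}^d$, the average of $\|\gamma_f(x+u)-\nabla f_r(x)\|$ over the sphere $\{\|u\|=\rho\}$ is at most $L_r$. * $\lambda_r$ is the (smallest) Lipschitz constant of $\nabla f_r$. * $\partial_rf(x)$ is the convex hull of $\{\nabla f(y):\|y-x\|\le r,\ f\text{ differentiable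 at }y\}$ (the Goldstein $r$-subdifferential). * For step sizes $a_i>0$ let $A_k=\sum_{i=0}^ka_i$, and let $\Pi_X$ be the Euclidean projection onto $X$. AGD+ on $f_r$ with the stochastic subgradient oracle $\gamma_f(x+ru)$ is the iteration $g_k=\gamma_f(x_k+ru_k)$ with $u_0,u_1,\dots$ i.i.d. uniform on the unit ball; $z_0=x_0-a_0g_0$, $y_0=\Pi_X(z_0)$; and for $k\ge1$ $$x_k=\tfrac{A_{k-1}}{A_k}y_{k-1}+\tfrac{a_k}{A_k}\Pi_X(z_{k-1}),\quad z_k=z_{k-1}-a_kg_k,\quad y_k=\tfrac{A_{k-1}}{A_k}y_{k-1}+\tfrac{a_k}{A_k}\Pi_X(z_k).$$ **Theorem.** There is an absolute constant $C>0$ such that the following holds in this setting whenever $f$ has a BVG$_{\max}$ constant at some radius $r_0>0$. Call a radius $r>0$ admissible if $f_r(x_*)-f(x_*)\le\epsilon/2$. For every admissible $r$, the function $f_r$ is differentiable, $\lambda_r$ is finite, and $f$ has finite BVG$_{\max}$ and BVG$_{\mathrm{avg}}$ constants at radius $r$. For any such constants $\hat L_r$ and $L_r$: 1. If the step sizes satisfy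 $\lambda_ra_k^2\le A_k$ for all $k\ge0$, then for all $k\ge0$, $f(y_k)$ is integrable and $$\mathbb{E}[f(y_k)-f(x_*)]\le\frac\epsilon2+\frac{\frac12\|x_*-x_0\|^2+\sum_{i=0}^ka_i^2\hat L_rL_r}{A_k}.$$ 2. There are step sizes $a_i>0$ with $\lambda_ra_k^2\le A_k$ for all $k$, and an integer $N\ge0$ with $$N\le C\left(\sqrt{\frac{\lambda_r}{\epsilon}}\,\|x_*-x_0\|+\frac{\hat L_rL_r\|x_*-x_0\|^2}{\epsilon^2}\right),$$ such that $f(y_k)$ is integrable and $\mathbb{E}[f(y_k)-f(x_*)]\le\epsilon$ for all $k\ge N$. 3. If $r$ is the largest admissible radius, then $$\lambda_r\le C\min\left\{\frac{L_r^2d}{\epsilon},\ \frac{L_r\hat L_r\sqrt d}{\epsilon}\right\},$$ and, for every $\kappa$ and every polytope $K_{x_*}\supseteq\partial_rf(x_*)$ of diameter at most $\kappa\hat L_r$ with $|\mathrm{vert}(K_{x_*})|$ vertices, $$\lambda_r\le C\min\left\{\frac{L_r^2d}{\epsilon},\ \frac{L_r\hat L_r\sqrt d}{\epsilon},\ \kappa\,\frac{\hat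 L_r^2\sqrt{\ln|\mathrm{vert}(K_{x_*})|}}{\epsilon}\right\}.$$ Moreover, a largest admissible radius exists, unless every $r>0$ is admissible and $\lambda_r=0$ for all $r>0$. -/

import Mathlib

open MeasureTheory ProbabilityTheory Set
open scoped NNReal RealInnerProductSpace

noncomputable section

/-- The Euclidean space `ℝ^d`. -/
abbrev E (d : ℕ) : Type := EuclideanSpace ℝ (Fin d)

/-- `γ` is a (Borel) measurable selection of the convex subdifferential of `f`:
`γ x ∈ ∂f(x)` for every `x`. -/
def IsSubgradientSelection {d : ℕ} (f : E d → ℝ) (γ : E d → E d) : Prop :=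
  Measurable γ ∧ ∀ x y : E d, f x + ⟪γ x, y - x⟫ ≤ f y

/-- The ball-smoothed function `f_r(x) = vol(B_r)⁻¹ ∫_{B_r} f(x + u) du`. -/
def smoothed {d : ℕ} (f : E d → ℝ) (r : ℝ) (x : E d) : ℝ :=
  ⨍ u in Metric.closedBall (0 : E d) r, f (x + u)

/-- `f`, with subgradient selection `γ`, has bounded maximum local variation of the subgradient
at radius `r`, with constant `L`. -/
def IsBVGMax {d : ℕ} (f : E d → ℝ) (γ : E d → E d) (r L : ℝ) : Prop :=
  LocallyLipschitz f ∧ 0 < L ∧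
    ∀ x u : E d, u ∈ Metric.closedBall (0 : E d) 1 → ‖γ (x + r • u) - γ x‖ ≤ L

/-- `f`, with subgradient selection `γ`, has bounded mean oscillation of the subgradient at
radius `r`, with constant `L`: for all `0 < ρ ≤ r` and all `x`, the average of
`‖γ(x + u) - ∇f_r(x)‖` over the sphere `‖u‖ = ρ` is at most `L`.  The average over the sphere of
radius `ρ` is written as an average over the unit sphere, with its surface measure. -/
def IsBVGAvg {d : ℕ} (f : E d → ℝ) (γ : E d → E d) (r L : ℝ) : Prop :=
  LocallyLipschitz f ∧
    ∀ ρ : ℝ, 0 < ρ → ρ ≤ r → ∀ x : E d,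
      (⨍ u : Metric.sphere (0 : E d) 1, ‖γ (x + ρ • (u : E d)) - gradient (smoothed f r) x‖
        ∂((volume : Measure (E d)).toSphere)) ≤ L

/-- The smallest Lipschitz constant of a map (when the map is Lipschitz). -/
def lipConst {d : ℕ} (g : E d → E d) : ℝ≥0 :=
  sInf {K : ℝ≥0 | LipschitzWith K g}

/-- `λ_r`, the Lipschitz constant of `∇f_r`. -/
def smoothness {d : ℕ} (f : E d → ℝ) (r : ℝ) : ℝ≥0 :=
  lipConst (gradient (smoothed f r))

/-- The Goldstein `r`-subdifferential of `f` at `x`. -/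
def goldstein {d : ℕ} (f : E d → ℝ) (r : ℝ) (x : E d) : Set (E d) :=
  convexHull ℝ (gradient f '' {y | y ∈ Metric.closedBall x r ∧ DifferentiableAt ℝ f y})

/-- A polytope: the convex hull of finitely many points. -/
def IsPolytope {d : ℕ} (K : Set (E d)) : Prop :=
  ∃ S : Set (E d), S.Finite ∧ K = convexHull ℝ S

/-- The number of vertices (extreme points) of a polytope. -/
def numVertices {d : ℕ} (K : Set (E d)) : ℕ :=
  (K.extremePoints ℝ).ncard

/-- The radii `ρ > 0` for which `f_ρ(x) - f(x) ≤ ε / 2`. -/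
def admissibleRadii {d : ℕ} (f : E d → ℝ) (x : E d) (ε : ℝ) : Set ℝ :=
  {ρ : ℝ | 0 < ρ ∧ smoothed f ρ x - f x ≤ ε / 2}

/-- The Euclidean projection `Π_X(z)`: the nearest point to `z` in `X`. -/
def proj {d : ℕ} (X : Set (E d)) (z : E d) : E d :=
  Classical.epsilon fun p => p ∈ X ∧ ∀ q ∈ X, dist z p ≤ dist z q

/-- On a nonempty closed set, `proj X z` is a point of `X` nearest to `z`. -/
theorem proj_spec {d : ℕ} {X : Set (E d)} (hX : IsClosed X) (hne : X.Nonempty) (z : E d) :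
    proj X z ∈ X ∧ ∀ q ∈ X, dist z (proj X z) ≤ dist z q := by
  have h : ∃ p, p ∈ X ∧ ∀ q ∈ X, dist z p ≤ dist z q := by
    obtain ⟨p, hp, hpz⟩ := hX.exists_infDist_eq_dist hne z
    exact ⟨p, hp, fun q hq => hpz ▸ Metric.infDist_le_dist_of_mem hq⟩
  exact Classical.epsilon_spec h

/-- `A_k = a_0 + ⋯ + a_k`. -/
def stepSum (a : ℕ → ℝ) (k : ℕ) : ℝ :=
  ∑ i ∈ Finset.range (k + 1), a i

/-- The iterates `(x_k, z_k, y_k)` of the algorithm AGD+. -/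
structure AGDState (d : ℕ) where
  x : E d
  z : E d
  y : E d

/-- AGD+ on the feasible set `X` with step sizes `a`, initial point `x₀` and gradient oracle `G`;
the gradient estimate in iteration `k` is `g_k = G k x_k`. -/
def agdPlus {d : ℕ} (X : Set (E d)) (a : ℕ → ℝ) (G : ℕ → E d → E d) (x₀ : E d) : ℕ → AGDState d
  | 0 =>
    let z := x₀ - a 0 • G 0 x₀
    ⟨x₀, z, proj X z⟩
  | k + 1 =>
    let p := agdPlus X a G x₀ k
    let α := stepSum a k / stepSum a (k + 1)
    let β := a (k + 1) / stepSum a (k + 1)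
    let x := α • p.y + β • proj X p.z
    let z := p.z - a (k + 1) • G (k + 1) x
    ⟨x, z, α • p.y + β • proj X z⟩

/-- The output `y_k` of AGD+ run with the stochastic gradient oracle `γ(x + r u)`, where
`u 0, u 1, …` are the sampled directions. -/
def smoothedAGD {d : ℕ} (X : Set (E d)) (a : ℕ → ℝ) (γ : E d → E d) (r : ℝ) (x₀ : E d)
    (u : ℕ → E d) (k : ℕ) : E d :=
  (agdPlus X a (fun i x => γ (x + r • u i)) x₀ k).y

/-- `u 0, u 1, …` are independent random vectors, uniformly distributed on the unit ball. -/
def IsUnifBallSample {d : ℕ} {Ω : Type*} [MeasurableSpace Ω] (P : Measure Ω)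
    (u : ℕ → Ω → E d) : Prop :=
  (∀ k, Measurable (u k)) ∧ iIndepFun u P ∧
    ∀ k, pdf.IsUniform (u k) (Metric.closedBall (0 : E d) 1) P volume

/-- Positive step sizes with `a_k² / A_k ≤ 1 / lam` for all `k`
(no constraint besides positivity when `lam = 0`). -/
def IsStepSize (a : ℕ → ℝ) (lam : ℝ) : Prop :=
  (∀ k, 0 < a k) ∧ ∀ k, lam * a k ^ 2 ≤ stepSum a k

end

noncomputable section

/-! ### Growth of subgradient selections of bounded local variation -/

/-! Averaging subgradient inequalities over the ball shows that the mean of `γ (x + r u)` is a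
subgradient of `f_r` at `x`. This mean is Lipschitz in `x`, so it is the gradient of `f_r`, and the
oracle of AGD+ is unbiased. Jensen gives `f ≤ f_r`, and admissibility bounds the gap `f_r - f` at
`x_*` by `ε / 2`; hence it is enough to minimize `f_r`.

Convergence. A potential argument for AGD+ (`agdPlus_gap_le`) bounds `A_k (f_r(y_k) - f_r(x_*))` by
`‖x_* - x_0‖² / 2` plus one error per iteration. The error pairs the noise with a projected point
that depends on the same noise. Replacing this point by the one that the exact gradient would give
costs `a² ‖noise‖²`, because projections are nonexpansive; what remains is linear in the noise and
has mean zero given the past. The variance is at most `L̂_r L_r`: one factor of the noise is bounded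
uniformly, the other on average (`IsBVGAvg.integral_norm_sq_le`). Step sizes `min ((i+1)/(2λ)) c`
then balance the two terms and give the complexity.

Smoothness. Means over two balls whose centres differ by `r h` differ only through the symmetric
difference of the balls. In units of the ball's volume each half of it has size `O(√d ‖h‖)`, because
an ellipsoid of nearly full volume fits in the intersection; this gives `λ_r = O(√d L̂_r / r)`. Each
half also lies in a shell of thickness `‖h‖`, up to translation; a shell is a union of spheres, on
which the averaged condition applies, and this gives `λ_r = O(d L_r / r)`.

Radius. At the largest admissible radius the gap at `x_*` is at least `ε / 2`, so upper bounds on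
the gap bound `1 / r`. The gap is at most `r L_r`; it is also at most a multiple of `r diam(K) √(log
|vert K| / d)`, by a union bound over the vertices and concentration of linear functions on the
ball. The gap divided by the radius is nondecreasing and the gap is locally Lipschitz in the radius,
so the largest radius exists unless the gap always vanishes, and then `f` is affine. -/

theorem IsBVGMax.norm_sub_le {d : ℕ} {f : E d → ℝ} {γ : E d → E d} {r L : ℝ}
    (h : IsBVGMax f γ r L) (hr : 0 < r) {x y : E d} (hxy : ‖y - x‖ ≤ r) : ‖γ y - γ x‖ ≤ L := by
  have := h.2.2 x (r⁻¹ • (y - x)) (by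
    rw [mem_closedBall_zero_iff, norm_smul, Real.norm_eq_abs, abs_of_pos (inv_pos.2 hr),
      inv_mul_le_iff₀ hr]
    simpa using hxy)
  rwa [smul_smul, mul_inv_cancel₀ hr.ne', one_smul, add_sub_cancel] at this

/-- Cut the segment into `n` pieces of length at most `r` and add the variations. This makes the
condition at one radius give it at every radius, and bounds `γ` on bounded sets. -/
theorem IsBVGMax.norm_sub_le_nat_mul {d : ℕ} {f : E d → ℝ} {γ : E d → E d} {r L : ℝ}
    (h : IsBVGMax f γ r L) (hr : 0 < r) (n : ℕ) :
    ∀ x y : E d, ‖y - x‖ ≤ n * r → ‖γ y - γ x‖ ≤ n * L := by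
  induction n with
  | zero =>
    intro x y hxy
    have : y = x := by simpa [sub_eq_zero] using hxy
    simp [this]
  | succ n ih =>
    intro x y hxy
    push_cast at hxy ⊢
    have hn : (0 : ℝ) < n + 1 := by positivity
    set z : E d := x + ((n : ℝ) / (n + 1)) • (y - x) with hz
    have h1 : ‖z - x‖ ≤ n * r := by
      rw [hz, add_sub_cancel_left, norm_smul, Real.norm_eq_abs, abs_of_nonneg (by positivity)]
      calc (n : ℝ) / (n + 1) * ‖y - x‖ ≤ n / (n + 1) * ((n + 1) * r) := by gcongr
        _ = n * r := by field_simp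
    have h2 : ‖y - z‖ ≤ r := by
      have : y - z = ((1 : ℝ) / (n + 1)) • (y - x) := by
        have h1 : (1 : ℝ) / (n + 1) = 1 - n / (n + 1) := by field_simp; ring
        rw [hz, h1, sub_smul, one_smul]; abel
      rw [this, norm_smul, Real.norm_eq_abs, abs_of_nonneg (by positivity)]
      calc 1 / ((n : ℝ) + 1) * ‖y - x‖ ≤ 1 / (n + 1) * ((n + 1) * r) := by gcongr
        _ = r := by field_simp
    calc ‖γ y - γ x‖ ≤ ‖γ y - γ z‖ + ‖γ z - γ x‖ := norm_sub_le_norm_sub_add_norm_sub ..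
      _ ≤ L + n * L := add_le_add (h.norm_sub_le hr h2) (ih _ _ h1)
      _ = (n + 1) * L := by ring

theorem IsBVGMax.exists_radius {d : ℕ} {f : E d → ℝ} {γ : E d → E d} {r L : ℝ}
    (h : IsBVGMax f γ r L) (hr : 0 < r) {r' : ℝ} (hr' : 0 < r') : ∃ L', IsBVGMax f γ r' L' := by
  refine ⟨(⌈r' / r⌉₊ : ℝ) * L, h.1, mul_pos ?_ h.2.1, fun x u hu => ?_⟩
  · exact_mod_cast Nat.ceil_pos.2 (div_pos hr' hr)
  · refine h.norm_sub_le_nat_mul hr _ _ _ ?_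
    rw [mem_closedBall_zero_iff] at hu
    rw [add_sub_cancel_left, norm_smul, Real.norm_eq_abs, abs_of_pos hr']
    calc r' * ‖u‖ ≤ r' := mul_le_of_le_one_right hr'.le hu
      _ ≤ _ := (div_le_iff₀ hr).1 (Nat.le_ceil _)

theorem IsBVGMax.norm_le {d : ℕ} {f : E d → ℝ} {γ : E d → E d} {r L : ℝ}
    (h : IsBVGMax f γ r L) (hr : 0 < r) (R : ℝ) : ∃ M, ∀ x : E d, ‖x‖ ≤ R → ‖γ x‖ ≤ M := by
  refine ⟨‖γ 0‖ + ⌈R / r⌉₊ * L, fun x hx => ?_⟩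
  have := h.norm_sub_le_nat_mul hr ⌈R / r⌉₊ 0 x
    (by rw [sub_zero]; exact hx.trans ((div_le_iff₀ hr).1 (Nat.le_ceil _)))
  calc ‖γ x‖ = ‖γ 0 + (γ x - γ 0)‖ := by rw [add_sub_cancel]
    _ ≤ ‖γ 0‖ + ‖γ x - γ 0‖ := norm_add_le _ _
    _ ≤ _ := by gcongr

/-! ### The uniform distribution on the unit ball -/

/-- The uniform distribution on the closed unit ball. -/
def unifBall (d : ℕ) : Measure (E d) := cond volume (Metric.closedBall (0 : E d) 1)

theorem volume_closedBall_ne_zero {d : ℕ} (x : E d) {r : ℝ} (hr : 0 < r) :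
    volume (Metric.closedBall x r) ≠ 0 := (Metric.measure_closedBall_pos _ _ hr).ne'

theorem volume_closedBall_ne_top {d : ℕ} (x : E d) (r : ℝ) :
    volume (Metric.closedBall x r) ≠ ⊤ := measure_closedBall_lt_top.ne

theorem volume_closedBall_pos (d : ℕ) : 0 < volume.real (Metric.closedBall (0 : E d) 1) :=
  ENNReal.toReal_pos (volume_closedBall_ne_zero _ one_pos) (volume_closedBall_ne_top _ _)

instance {d : ℕ} : IsProbabilityMeasure (unifBall d) :=
  cond_isProbabilityMeasure_of_finite (volume_closedBall_ne_zero _ one_pos)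
    (volume_closedBall_ne_top _ _)

theorem ae_unifBall {d : ℕ} {p : E d → Prop} (h : ∀ u, ‖u‖ ≤ 1 → p u) :
    ∀ᵐ u ∂unifBall d, p u := by
  filter_upwards [ae_cond_mem (μ := (volume : Measure (E d)))
    (s := Metric.closedBall (0 : E d) 1) measurableSet_closedBall] with u hu
  exact h u (mem_closedBall_zero_iff.1 hu)

theorem integrable_unifBall {d : ℕ} {F : Type*} [NormedAddCommGroup F] {g : E d → F}
    (hg : AEStronglyMeasurable g (unifBall d)) (C : ℝ) (hC : ∀ u, ‖u‖ ≤ 1 → ‖g u‖ ≤ C) :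
    Integrable g (unifBall d) :=
  Integrable.of_bound hg C (ae_unifBall hC)

theorem integral_unifBall {d : ℕ} {F : Type*} [NormedAddCommGroup F] [NormedSpace ℝ F]
    (g : E d → F) : ∫ u, g u ∂unifBall d =
      (volume.real (Metric.closedBall (0 : E d) 1))⁻¹ • ∫ u in Metric.closedBall (0 : E d) 1, g u := by
  rw [unifBall, ProbabilityTheory.cond, integral_smul_measure, ENNReal.toReal_inv]; rfl

open Pointwise in
theorem smoothed_eq {d : ℕ} (f : E d → ℝ) {r : ℝ} (hr : 0 < r) (x : E d) :
    smoothed f r x = ∫ u, f (x + r • u) ∂unifBall d := by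
  have h1 : r • Metric.closedBall (0 : E d) 1 = Metric.closedBall 0 r := by
    rw [smul_closedBall _ _ zero_le_one]; simp [abs_of_pos hr]
  have h2 : volume.real (Metric.closedBall (0 : E d) r) =
      r ^ (Module.finrank ℝ (E d)) * volume.real (Metric.closedBall (0 : E d) 1) := by
    rw [Measure.addHaar_real_closedBall' _ _ hr.le]
  rw [integral_unifBall, Measure.setIntegral_comp_smul_of_pos volume (fun u => f (x + u)) _ hr, h1,
    smoothed, setAverage_eq, h2, mul_inv, smul_smul, mul_comm]

theorem integral_unifBall_id (d : ℕ) : ∫ u, u ∂unifBall d = 0 := by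
  rw [integral_unifBall]
  have : ∫ u in Metric.closedBall (0 : E d) 1, u = - ∫ u in Metric.closedBall (0 : E d) 1, u := by
    rw [← integral_neg]
    have := (Measure.measurePreserving_neg (volume : Measure (E d))).setIntegral_preimage_emb
      (MeasurableEquiv.neg (E d)).measurableEmbedding (fun u => u) (Metric.closedBall (0 : E d) 1)
    rw [← this]
    simp
  have h2 : (2 : ℝ) • ∫ u in Metric.closedBall (0 : E d) 1, u = 0 := by
    rw [two_smul]; nth_rewrite 2 [this]; rw [add_neg_cancel]
  rw [(smul_eq_zero.1 h2).resolve_left two_ne_zero, smul_zero]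

theorem integrable_unifBall_id (d : ℕ) : Integrable (fun u => u) (unifBall d) :=
  integrable_unifBall aestronglyMeasurable_id 1 fun _ h => h

theorem integrable_inner_unifBall {d : ℕ} (v : E d) :
    Integrable (fun u => ⟪v, u⟫) (unifBall d) :=
  (integrable_unifBall_id d).const_inner v

theorem integral_inner_unifBall {d : ℕ} (v : E d) : ∫ u, ⟪v, u⟫ ∂unifBall d = 0 := by
  rw [integral_inner (integrable_unifBall_id d), integral_unifBall_id, inner_zero_right]

theorem integrable_comp_unifBall {d : ℕ} {f : E d → ℝ} (hf : Continuous f) (r : ℝ) (x : E d) :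
    Integrable (fun u => f (x + r • u)) (unifBall d) := by
  have hc : Continuous fun u => f (x + r • u) := by fun_prop
  obtain ⟨C, hC⟩ := (isCompact_closedBall (0 : E d) 1).exists_bound_of_continuousOn hc.continuousOn
  exact integrable_unifBall hc.aestronglyMeasurable C
    fun u hu => hC u (mem_closedBall_zero_iff.2 hu)

/-- The expectation of `γ (x + r u)` over the unit ball. -/
def meanSubgradient {d : ℕ} (γ : E d → E d) (r : ℝ) (x : E d) : E d :=
  ∫ u, γ (x + r • u) ∂unifBall d

theorem norm_add_smul_le {d : ℕ} {x u : E d} {r : ℝ} (hr : 0 < r) (hu : ‖u‖ ≤ 1) :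
    ‖x + r • u‖ ≤ ‖x‖ + r := by
  refine (norm_add_le _ _).trans ?_
  rw [norm_smul, Real.norm_eq_abs, abs_of_pos hr]
  gcongr
  exact mul_le_of_le_one_right hr.le hu

theorem IsBVGMax.integrable {d : ℕ} {f : E d → ℝ} {γ : E d → E d} {r L : ℝ}
    (h : IsBVGMax f γ r L) (hr : 0 < r) (hγ : Measurable γ) {r' : ℝ} (hr' : 0 < r') (x : E d) :
    Integrable (fun u => γ (x + r' • u)) (unifBall d) := by
  obtain ⟨M, hM⟩ := h.norm_le hr (‖x‖ + r')
  exact integrable_unifBall (Measurable.aestronglyMeasurable (by fun_prop)) M fun u hu => hM _ (norm_add_smul_le hr' hu)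

/-- Average the subgradient inequality between the shifted points `x + r u` and `y + r u`. -/
theorem smoothed_subgradient {d : ℕ} {f : E d → ℝ} {γ : E d → E d} {r L : ℝ}
    (h : IsBVGMax f γ r L) (hr : 0 < r) (hγ : IsSubgradientSelection f γ) (x y : E d) :
    smoothed f r x + ⟪meanSubgradient γ r x, y - x⟫ ≤ smoothed f r y := by
  have hi := h.integrable hr hγ.1 hr x
  have hf := fun x => integrable_comp_unifBall h.1.continuous r x
  rw [smoothed_eq f hr, smoothed_eq f hr, meanSubgradient, real_inner_comm,
    ← integral_inner hi, ← integral_add (hf x) (hi.const_inner _)]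
  refine integral_mono ((hf x).add (hi.const_inner _)) (hf y) fun u => ?_
  have := hγ.2 (x + r • u) (y + r • u)
  rwa [add_sub_add_right_eq_sub, real_inner_comm] at this

/-- Jensen: the affine minorant of `f` at `x` has mean `f x`, since `u` is centred. -/
theorem le_smoothed {d : ℕ} {f : E d → ℝ} {γ : E d → E d} (hf : Continuous f)
    (hγ : IsSubgradientSelection f γ) {r : ℝ} (hr : 0 < r) (x : E d) : f x ≤ smoothed f r x := by
  rw [smoothed_eq f hr]
  have h1 : ∫ u, (f x + r * ⟪γ x, u⟫) ∂unifBall d = f x := by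
    rw [integral_add (integrable_const _) ((integrable_inner_unifBall _).const_mul _),
      integral_const_mul, integral_inner_unifBall]
    simp
  rw [← h1]
  refine integral_mono ((integrable_const _).add ((integrable_inner_unifBall _).const_mul _))
    (integrable_comp_unifBall hf r x) fun u => ?_
  have := hγ.2 x (x + r • u)
  rwa [add_sub_cancel_left, real_inner_smul_right] at this

/-- A function with a continuous (Lipschitz) subgradient selection is differentiable. -/
theorem hasGradientAt_of_lipschitz_subgradient {d : ℕ} {F : E d → ℝ} {G : E d → E d} {K : ℝ≥0}
    (hG : LipschitzWith K G) (h : ∀ x y, F x + ⟪G x, y - x⟫ ≤ F y) (x : E d) :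
    HasGradientAt F (G x) x := by
  rw [hasGradientAt_iff_isLittleO]
  -- The subgradient inequalities at `x` and at `y` squeeze the remainder between `0` and `⟪G y - G
  -- x, y - x⟫`, so no differentiation under the integral is needed later.
  have hO : (fun y => F y - F x - ⟪G x, y - x⟫) =O[nhds x] fun y => ‖y - x‖ ^ 2 := by
    refine Asymptotics.IsBigO.of_bound K (Filter.Eventually.of_forall fun y => ?_)
    have h1 := h x y
    have h2 := h y x
    have h3 : ⟪G y, x - y⟫ = -⟪G y, y - x⟫ := by rw [← inner_neg_right, neg_sub]
    have h4 : ⟪G y - G x, y - x⟫ ≤ K * ‖y - x‖ ^ 2 := by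
      calc ⟪G y - G x, y - x⟫ ≤ ‖G y - G x‖ * ‖y - x‖ := real_inner_le_norm _ _
        _ ≤ K * ‖y - x‖ * ‖y - x‖ := by
          gcongr; simpa [dist_eq_norm] using hG.dist_le_mul y x
        _ = _ := by ring
    rw [inner_sub_left] at h4
    rw [Real.norm_eq_abs, abs_of_nonneg (by linarith), Real.norm_eq_abs, abs_of_nonneg (by positivity)]
    linarith
  refine hO.trans_isLittleO ?_
  have := (Asymptotics.isLittleO_pow_sub_sub x (m := 2) one_lt_two).norm_norm
  refine Asymptotics.IsLittleO.of_norm_right ?_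
  simpa using this

/-- A uniform Lipschitz estimate at small distances is a global one. -/
theorem dist_le_of_uniform_local {V W : Type*} [NormedAddCommGroup V] [NormedSpace ℝ V]
    [PseudoMetricSpace W] {G : V → W} {K δ : ℝ} (hδ : 0 < δ)
    (h : ∀ x y, ‖y - x‖ ≤ δ → dist (G y) (G x) ≤ K * ‖y - x‖) (x y : V) :
    dist (G y) (G x) ≤ K * ‖y - x‖ := by
  obtain ⟨n, hn⟩ := exists_nat_gt (‖y - x‖ / δ)
  have hn0 : (0 : ℝ) < n := (div_nonneg (norm_nonneg _) hδ.le).trans_lt hn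
  have step : ∀ k : ℕ, dist (G (x + ((k : ℝ) / n) • (y - x))) (G x) ≤ k * (K * (‖y - x‖ / n)) := by
    intro k
    induction k with
    | zero => simp
    | succ k ih =>
      have e : x + (((k + 1 : ℕ) : ℝ) / n) • (y - x) - (x + ((k : ℝ) / n) • (y - x)) =
          ((1 : ℝ) / n) • (y - x) := by
        rw [add_sub_add_left_eq_sub, ← sub_smul]; push_cast; congr 1; ring
      have e' : ‖x + (((k + 1 : ℕ) : ℝ) / n) • (y - x) - (x + ((k : ℝ) / n) • (y - x))‖ =
          ‖y - x‖ / n := by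
        rw [e, norm_smul, Real.norm_eq_abs, abs_of_pos (by positivity)]; ring
      have h1 := h (x + ((k : ℝ) / n) • (y - x)) (x + (((k + 1 : ℕ) : ℝ) / n) • (y - x)) (by
        rw [e', div_le_iff₀ hn0, mul_comm]; exact ((div_lt_iff₀ hδ).1 hn).le)
      rw [e'] at h1
      calc _ ≤ _ := dist_triangle _ (G (x + ((k : ℝ) / n) • (y - x))) _
        _ ≤ K * (‖y - x‖ / n) + k * (K * (‖y - x‖ / n)) := add_le_add h1 ih
        _ = _ := by push_cast; ring
  have := step n
  rw [div_self hn0.ne', one_smul, add_sub_cancel] at this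
  refine this.trans_eq ?_
  field_simp

/-! ### Overlap of translated balls -/

/-- The unit ball, shrunk by `1 - η/(2w)` in all directions and further by `1 - w η` along `e`,
still fits in the unit ball after a shift by `± (η/2) e`. With `w = √d` both shrinkings cost a
fraction of order `√d η` of the volume. -/
theorem norm_ellipsoid_add_sq_le {V : Type*} [NormedAddCommGroup V] [InnerProductSpace ℝ V]
    {e u : V} (he : ‖e‖ = 1) (hu : ‖u‖ ≤ 1) {w η σ : ℝ} (hw : 1 ≤ w) (hη : 0 < η)
    (hwη : w * η ≤ 1 / 2) (hσ : σ ^ 2 = 1) :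
    ‖(σ * (η / 2)) • e + (1 - η / (2 * w)) • (u + (⟪e, u⟫) • (-(w * η)) • e)‖ ≤ 1 := by
  set β := 1 - η / (2 * w) with hβ
  set x := ⟪e, u⟫ with hx
  have hee : ⟪e, e⟫ = 1 := by rw [real_inner_self_eq_norm_sq, he]; norm_num
  have hxe : ⟪u, e⟫ = x := by rw [real_inner_comm]
  have hexp : ‖(σ * (η / 2)) • e + β • (u + x • (-(w * η)) • e)‖ ^ 2 =
      σ ^ 2 * η ^ 2 / 4 + σ * η * β * (1 - w * η) * x +
        β ^ 2 * (‖u‖ ^ 2 - (2 * (w * η) - (w * η) ^ 2) * x ^ 2) := by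
    rw [← real_inner_self_eq_norm_sq, ← real_inner_self_eq_norm_sq]
    simp only [inner_add_left, inner_add_right, real_inner_smul_left, real_inner_smul_right,
      hee, hxe, ← hx]
    ring
  rw [hσ] at hexp
  have hw0 : 0 < w := by linarith
  have hηle : η ≤ 1 / (2 * w) := by rw [le_div_iff₀ (by positivity)]; linarith
  have hη1 : η ≤ 1 / 2 := by nlinarith
  have hη2 : η / (2 * w) ≤ 1 / 4 := by
    rw [div_le_iff₀ (by positivity)]; nlinarith
  have hβ0 : 0 ≤ β := by linarith
  have hβ1 : β ≤ 1 := by have : 0 ≤ η / (2 * w) := by positivity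
                         linarith
  have hβ2 : β ^ 2 ≤ β := by nlinarith
  have hu2 : ‖u‖ ^ 2 ≤ 1 := by nlinarith [norm_nonneg u]
  -- The term linear in `x` is absorbed, by completing the square, into the quadratic term saved by
  -- the shrinking along `e`. The remainder `η/(4w)` and the shift's `η²/4 ≤ η/(8w)` are paid by `β²
  -- ≤ 1 - η/(2w)`.
  have h1 : σ * η * β * (1 - w * η) * x ≤ β ^ 2 * (w * η) * x ^ 2 + η / (4 * w) := by
    have hs : 0 < w * η := by positivity
    have key : 0 ≤ (2 * β * (w * η) * x - σ * η * (1 - w * η)) ^ 2 := sq_nonneg _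
    have h3 : (1 - w * η) ^ 2 ≤ 1 := by nlinarith
    have h4 : η ^ 2 * (1 - w * η) ^ 2 ≤ η ^ 2 := mul_le_of_le_one_right (by positivity) h3
    have h2 : 4 * (w * η) * (σ * η * β * (1 - w * η) * x) ≤
        4 * (w * η) * (β ^ 2 * (w * η) * x ^ 2 + η / (4 * w)) := by
      have e1 : 4 * (w * η) * (β ^ 2 * (w * η) * x ^ 2 + η / (4 * w)) =
        4 * (w * η) ^ 2 * β ^ 2 * x ^ 2 + η ^ 2 := by field_simp
      have e2 : (2 * β * (w * η) * x - σ * η * (1 - w * η)) ^ 2 =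
        4 * (w * η) ^ 2 * β ^ 2 * x ^ 2 - 4 * (w * η) * (σ * η * β * (1 - w * η) * x) +
          σ ^ 2 * (η ^ 2 * (1 - w * η) ^ 2) := by ring
      rw [hσ] at e2
      linarith
    exact le_of_mul_le_mul_left h2 (by positivity)
  have h5 : β ^ 2 * (‖u‖ ^ 2 - (2 * (w * η) - (w * η) ^ 2) * x ^ 2) ≤
      β ^ 2 - β ^ 2 * (w * η) * x ^ 2 := by
    have : (w * η) * x ^ 2 ≤ (2 * (w * η) - (w * η) ^ 2) * x ^ 2 := by
      gcongr; nlinarith [mul_pos hw0 hη]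
    have := mul_le_mul_of_nonneg_left (by linarith :
      ‖u‖ ^ 2 - (2 * (w * η) - (w * η) ^ 2) * x ^ 2 ≤ 1 - (w * η) * x ^ 2) (sq_nonneg β)
    linarith
  have h6 : η ^ 2 / 4 ≤ η / (8 * w) := by
    have := mul_le_mul_of_nonneg_left hηle hη.le
    have e : η * (1 / (2 * w)) = 4 * (η / (8 * w)) := by field_simp; norm_num
    rw [e] at this
    linarith [sq η]
  have h7 : η / (8 * w) = η / (2 * w) / 4 := by field_simp; norm_num
  have h8 : η / (4 * w) = η / (2 * w) / 2 := by field_simp; norm_num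
  have h9 : 0 < η / (2 * w) := by positivity
  have : ‖(σ * (η / 2)) • e + β • (u + x • (-(w * η)) • e)‖ ^ 2 ≤ 1 := by
    rw [hexp]; linarith
  exact (sq_le_one_iff₀ (norm_nonneg _)).1 this

/-- The intersection contains an ellipsoid centred at `h / 2`. Its relative volume is the
determinant `(1 - ‖h‖/(2√d))^d (1 - √d ‖h‖)`, estimated by Bernoulli's inequality. -/
theorem volume_inter_translate_ge {d : ℕ} (hd : 0 < d) {h : E d} (hh : √d * ‖h‖ ≤ 1 / 2) :
    (1 - 3 / 2 * (√d * ‖h‖)) * volume.real (Metric.closedBall (0 : E d) 1) ≤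
      volume.real (Metric.closedBall (0 : E d) 1 ∩ Metric.closedBall h 1) := by
  rcases eq_or_ne h 0 with rfl | h0
  · simp
  have hη : 0 < ‖h‖ := norm_pos_iff.2 h0
  have hw : 1 ≤ √(d : ℝ) := Real.one_le_sqrt.2 (by exact_mod_cast hd)
  set e : E d := ‖h‖⁻¹ • h with he_def
  have he : ‖e‖ = 1 := by rw [he_def, norm_smul, norm_inv, norm_norm, inv_mul_cancel₀ hη.ne']
  have hhe : ‖h‖ • e = h := by rw [he_def, smul_smul, mul_inv_cancel₀ hη.ne', one_smul]
  have hee : ⟪e, e⟫ = 1 := by rw [real_inner_self_eq_norm_sq, he]; norm_num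
  set T : E d →ₗ[ℝ] E d := (1 - ‖h‖ / (2 * √d)) •
    LinearMap.transvection (innerSL ℝ e).toLinearMap ((-(√d * ‖h‖)) • e) with hT
  have hTu : ∀ u, T u = (1 - ‖h‖ / (2 * √d)) • (u + ⟪e, u⟫ • (-(√d * ‖h‖)) • e) := fun u => rfl
  have hsub : (fun z => (1 / 2 : ℝ) • h + z) '' (T '' Metric.closedBall 0 1) ⊆
      Metric.closedBall (0 : E d) 1 ∩ Metric.closedBall h 1 := by
    rintro _ ⟨_, ⟨u, hu, rfl⟩, rfl⟩
    rw [mem_closedBall_zero_iff] at hu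
    have h1 := norm_ellipsoid_add_sq_le he hu hw hη hh (σ := 1) (by norm_num)
    have h2 := norm_ellipsoid_add_sq_le he hu hw hη hh (σ := -1) (by norm_num)
    rw [← hTu] at h1 h2
    have e1 : (1 / 2 : ℝ) • h = (1 * (‖h‖ / 2)) • e := by
      calc (1 / 2 : ℝ) • h = (1 / 2 : ℝ) • (‖h‖ • e) := by rw [hhe]
        _ = _ := by rw [smul_smul]; congr 1; ring
    have e2 : (1 / 2 : ℝ) • h + T u - h = (-1 * (‖h‖ / 2)) • e + T u := by
      calc (1 / 2 : ℝ) • h + T u - h = (1 / 2 : ℝ) • (‖h‖ • e) + T u - ‖h‖ • e := by rw [hhe]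
        _ = _ := by module
    constructor
    · rw [mem_closedBall_zero_iff]
      simpa only [e1] using h1
    · rw [mem_closedBall_iff_norm]
      simpa only [e2] using h2
  have hdet : T.det = (1 - ‖h‖ / (2 * √d)) ^ d * (1 - √d * ‖h‖) := by
    rw [hT, LinearMap.det_smul, LinearMap.transvection.det, finrank_euclideanSpace_fin]
    congr 1
    have : (innerSL ℝ e).toLinearMap ((-(√d * ‖h‖)) • e) = -(√d * ‖h‖) := by
      rw [map_smul]
      change _ • ⟪e, e⟫ = _
      rw [hee, smul_eq_mul, mul_one]
    rw [this]; ring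
  have hvol : volume.real ((fun z => (1 / 2 : ℝ) • h + z) '' (T '' Metric.closedBall 0 1)) =
      |T.det| * volume.real (Metric.closedBall (0 : E d) 1) := by
    rw [measureReal_def, image_add_left, measure_preimage_add, Measure.addHaar_image_linearMap,
      ENNReal.toReal_mul, ENNReal.toReal_ofReal (abs_nonneg _)]; rfl
  refine le_trans ?_ ((hvol.symm.le).trans (measureReal_mono hsub
    (measure_inter_lt_top_of_left_ne_top (volume_closedBall_ne_top _ _)).ne))
  gcongr
  refine le_trans ?_ (le_abs_self _)
  rw [hdet]
  have hw0 : 0 < √(d : ℝ) := by linarith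
  have hbern : 1 - √d * ‖h‖ / 2 ≤ (1 - ‖h‖ / (2 * √d)) ^ d := by
    have h2 : ‖h‖ / (2 * √d) ≤ 1 := by
      rw [div_le_iff₀ (by positivity)]; nlinarith
    have := one_add_mul_le_pow (a := -(‖h‖ / (2 * √d))) (by linarith) d
    refine le_trans (le_of_eq ?_) this
    have h3 : (d : ℝ) = √d * √d := (Real.mul_self_sqrt (by positivity)).symm
    have h4 : (d : ℝ) * -(‖h‖ / (2 * √d)) = -(√d * ‖h‖ / 2) := by
      nth_rewrite 1 [h3]; field_simp
    rw [h4]; ring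
  calc 1 - 3 / 2 * (√d * ‖h‖) ≤ (1 - √d * ‖h‖ / 2) * (1 - √d * ‖h‖) := by
        nlinarith [sq_nonneg (√d * ‖h‖)]
    _ ≤ _ := by gcongr; linarith

theorem volume_diff_translate_le {d : ℕ} (hd : 0 < d) {h : E d} (hh : √d * ‖h‖ ≤ 1 / 2) :
    volume.real (Metric.closedBall (0 : E d) 1 \ Metric.closedBall h 1) ≤
      3 / 2 * (√d * ‖h‖) * volume.real (Metric.closedBall (0 : E d) 1) ∧
    volume.real (Metric.closedBall h 1 \ Metric.closedBall (0 : E d) 1) ≤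
      3 / 2 * (√d * ‖h‖) * volume.real (Metric.closedBall (0 : E d) 1) := by
  have h1 := volume_inter_translate_ge hd hh
  have h2 : volume.real (Metric.closedBall h 1) = volume.real (Metric.closedBall (0 : E d) 1) := by
    rw [Measure.addHaar_real_closedBall' _ _ zero_le_one, one_pow, one_mul]
  have h3 := measureReal_sdiff_add_inter (μ := volume) (s := Metric.closedBall (0 : E d) 1)
    (measurableSet_closedBall (x := h) (ε := 1)) (volume_closedBall_ne_top _ _)
  have h4 := measureReal_sdiff_add_inter (μ := volume) (s := Metric.closedBall h 1)
    (measurableSet_closedBall (x := (0 : E d)) (ε := 1)) (volume_closedBall_ne_top _ _)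
  rw [inter_comm, h2] at h4
  constructor <;> linarith

/-! ### Lipschitz continuity of the mean subgradient -/

theorem integrableOn_comp_of_bounded {d : ℕ} {γ : E d → E d} (hγ : Measurable γ)
    (hb : ∀ R, ∃ M, ∀ x : E d, ‖x‖ ≤ R → ‖γ x‖ ≤ M) (x c h : E d) (r ρ : ℝ) :
    IntegrableOn (fun u => γ (x + r • u) - c) (Metric.closedBall h ρ) := by
  obtain ⟨M, hM⟩ := hb (‖x‖ + |r| * (‖h‖ + ρ))
  refine (Measure.integrableOn_of_bounded (M := M) (volume_closedBall_ne_top _ _)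
    (Measurable.aestronglyMeasurable (by fun_prop)) ?_).sub
    (integrableOn_const (volume_closedBall_ne_top _ _))
  filter_upwards [ae_restrict_mem measurableSet_closedBall] with u hu
  refine hM _ ((norm_add_le _ _).trans ?_)
  rw [norm_smul, Real.norm_eq_abs]
  gcongr
  calc ‖u‖ = ‖h + (u - h)‖ := by rw [add_sub_cancel]
    _ ≤ ‖h‖ + ‖u - h‖ := norm_add_le _ _
    _ ≤ _ := by gcongr; exact mem_closedBall_iff_norm.1 hu

/-- The integrals over the intersection of the two balls cancel. Any constant `c` may be subtracted
from `γ`, because the balls have equal volume; the two uses below choose it differently. -/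
theorem norm_meanSubgradient_sub_le {d : ℕ} {γ : E d → E d} (hγ : Measurable γ)
    (hb : ∀ R, ∃ M, ∀ x : E d, ‖x‖ ≤ R → ‖γ x‖ ≤ M) (r : ℝ) (x h c : E d) :
    volume.real (Metric.closedBall (0 : E d) 1) *
        ‖meanSubgradient γ r (x + r • h) - meanSubgradient γ r x‖ ≤
      (∫ u in Metric.closedBall (0 : E d) 1 \ Metric.closedBall h 1, ‖γ (x + r • u) - c‖) +
      ∫ u in Metric.closedBall h 1 \ Metric.closedBall (0 : E d) 1, ‖γ (x + r • u) - c‖ := by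
  set B := Metric.closedBall (0 : E d) 1
  set B' := Metric.closedBall h 1
  set g : E d → E d := fun u => γ (x + r • u) - c with hg
  have hV : 0 < volume.real B := volume_closedBall_pos d
  have hiB : IntegrableOn g B := integrableOn_comp_of_bounded hγ hb x c 0 r 1
  have hiB' : IntegrableOn g B' := integrableOn_comp_of_bounded hγ hb x c h r 1
  have hmean : ∀ y, volume.real B • (meanSubgradient γ r y - c) =
      ∫ u in B, (γ (y + r • u) - c) := by
    intro y
    have := integrableOn_comp_of_bounded hγ hb y 0 0 r 1
    simp only [sub_zero] at this
    rw [integral_sub this (integrableOn_const (volume_closedBall_ne_top _ _)), setIntegral_const,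
      meanSubgradient, integral_unifBall, smul_sub, smul_smul, mul_inv_cancel₀ hV.ne', one_smul]
  have htr : ∫ u in B, (γ (x + r • h + r • u) - c) = ∫ u in B', g u := by
    have := (measurePreserving_add_left (volume : Measure (E d)) h).setIntegral_preimage_emb
      (MeasurableEquiv.addLeft h).measurableEmbedding g B'
    rw [← this]
    have hpre : (fun u => h + u) ⁻¹' B' = B := by
      ext u; simp [B, B']
    rw [hpre]
    simp only [hg, smul_add, add_assoc]
  have e1 : volume.real B • (meanSubgradient γ r (x + r • h) - meanSubgradient γ r x) =
      (∫ u in B' \ B, g u) - ∫ u in B \ B', g u := by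
    rw [← sub_sub_sub_cancel_right _ _ c, smul_sub, hmean, hmean, htr,
      ← integral_inter_add_sdiff (s := B') (t := B) measurableSet_closedBall hiB',
      ← integral_inter_add_sdiff (s := B) (t := B') measurableSet_closedBall hiB,
      inter_comm B B']
    abel
  have e2 := congrArg norm e1
  rw [norm_smul, Real.norm_eq_abs, abs_of_pos hV] at e2
  rw [e2]
  refine (norm_sub_le _ _).trans ?_
  rw [add_comm]
  exact add_le_add (norm_integral_le_integral_norm _) (norm_integral_le_integral_norm _)

theorem setIntegral_norm_le_of_bound {d : ℕ} {g : E d → E d} {s t : Set (E d)} {C : ℝ}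
    (ht : volume t ≠ ⊤) (hst : s ⊆ t) (hC : ∀ u ∈ s, ‖g u‖ ≤ C) :
    ∫ u in s, ‖g u‖ ≤ C * volume.real s := by
  have hs' : volume s < ⊤ := (measure_mono hst).trans_lt ht.lt_top
  have := norm_setIntegral_le_of_norm_le_const (f := fun u => ‖g u‖) (C := C) hs'
    (fun u hu => by rw [norm_norm]; exact hC u hu)
  exact (le_abs_self _).trans this

theorem IsBVGMax.dist_meanSubgradient_le {d : ℕ} (hd : 0 < d) {f : E d → ℝ} {γ : E d → E d}
    {r L : ℝ} (h : IsBVGMax f γ r L) (hr : 0 < r) (hγ : Measurable γ) (x y : E d) :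
    dist (meanSubgradient γ r y) (meanSubgradient γ r x) ≤ 9 / 2 * √d * L / r * ‖y - x‖ := by
  have hw : 1 ≤ √(d : ℝ) := Real.one_le_sqrt.2 (by exact_mod_cast hd)
  -- This `δ` gives `√d ‖v‖ ≤ 1/2` for the rescaled displacement `v`, as the volume estimate
  -- requires.
  refine dist_le_of_uniform_local (δ := r / (2 * √d)) (by positivity) (fun x y hxy => ?_) x y
  set v : E d := r⁻¹ • (y - x) with hv
  have hy : y = x + r • v := by rw [hv, smul_smul, mul_inv_cancel₀ hr.ne', one_smul, add_sub_cancel]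
  have hvn : ‖v‖ = ‖y - x‖ / r := by
    rw [hv, norm_smul, norm_inv, Real.norm_eq_abs, abs_of_pos hr]; ring
  have hvs : √d * ‖v‖ ≤ 1 / 2 := by
    rw [le_div_iff₀ (by positivity)] at hxy
    rw [hvn, mul_div_assoc', div_le_iff₀ hr]; linarith
  have hv1 : ‖v‖ ≤ 1 := by nlinarith [norm_nonneg v]
  obtain ⟨h1, h2⟩ := volume_diff_translate_le hd hvs
  have key := norm_meanSubgradient_sub_le hγ (h.norm_le hr) r x v (γ x)
  have hV : 0 < volume.real (Metric.closedBall (0 : E d) 1) := volume_closedBall_pos d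
  have i1 := setIntegral_norm_le_of_bound (g := fun u => γ (x + r • u) - γ x)
    (volume_closedBall_ne_top (0 : E d) 1)
    (s := Metric.closedBall (0 : E d) 1 \ Metric.closedBall v 1) sdiff_subset
    (C := L) (fun u hu => h.2.2 x u hu.1)
  -- These points may lie outside the ball about `x`, so `γ` is compared through the centre `x + r
  -- v`. The bounds `L` and `2 L` add up to `9/2 = (3/2) · 3`.
  have i2 := setIntegral_norm_le_of_bound (g := fun u => γ (x + r • u) - γ x)
    (volume_closedBall_ne_top v 1)
    (s := Metric.closedBall v 1 \ Metric.closedBall (0 : E d) 1) sdiff_subset (C := 2 * L) (fun u hu => by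
      have a1 := h.2.2 x v (mem_closedBall_zero_iff.2 hv1)
      have a2 := h.2.2 (x + r • v) (u - v) (mem_closedBall_zero_iff.2 (mem_closedBall_iff_norm.1 hu.1))
      rw [add_assoc, ← smul_add, add_sub_cancel] at a2
      calc _ ≤ ‖γ (x + r • u) - γ (x + r • v)‖ + ‖γ (x + r • v) - γ x‖ :=
            norm_sub_le_norm_sub_add_norm_sub ..
        _ ≤ 2 * L := by linarith)
  have hL := h.2.1
  rw [← hy] at key
  rw [dist_eq_norm]
  have e : 9 / 2 * √d * L / r * ‖y - x‖ = 9 / 2 * (√d * ‖v‖) * L := by rw [hvn]; ring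
  rw [e]
  refine le_of_mul_le_mul_left (a := volume.real (Metric.closedBall (0 : E d) 1)) ?_ hV
  have j1 := mul_le_mul_of_nonneg_left h1 hL.le
  have j2 := mul_le_mul_of_nonneg_left h2 (by positivity : 0 ≤ 2 * L)
  linarith

theorem IsBVGMax.hasGradientAt_smoothed {d : ℕ} (hd : 0 < d) {f : E d → ℝ} {γ : E d → E d}
    {r L : ℝ} (h : IsBVGMax f γ r L) (hr : 0 < r) (hγ : IsSubgradientSelection f γ) (x : E d) :
    HasGradientAt (smoothed f r) (meanSubgradient γ r x) x := by
  have hL := h.2.1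
  refine hasGradientAt_of_lipschitz_subgradient (K := ⟨9 / 2 * √d * L / r, by positivity⟩)
    (LipschitzWith.of_dist_le_mul fun x y => ?_) (smoothed_subgradient h hr hγ) x
  rw [dist_eq_norm x y]
  exact h.dist_meanSubgradient_le hd hr hγ.1 y x

theorem IsBVGMax.gradient_smoothed {d : ℕ} (hd : 0 < d) {f : E d → ℝ} {γ : E d → E d}
    {r L : ℝ} (h : IsBVGMax f γ r L) (hr : 0 < r) (hγ : IsSubgradientSelection f γ) :
    gradient (smoothed f r) = meanSubgradient γ r :=
  funext fun x => (h.hasGradientAt_smoothed hd hr hγ x).gradient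

/-- The infimum is attained, since every difference quotient is a lower bound of the set of
Lipschitz constants. -/
theorem lipschitzWith_lipConst {d : ℕ} {g : E d → E d} {K : ℝ≥0} (h : LipschitzWith K g) :
    LipschitzWith (lipConst g) g := by
  refine LipschitzWith.of_dist_le_mul fun x y => ?_
  rcases eq_or_ne x y with rfl | hxy
  · simp
  rw [← div_le_iff₀ (dist_pos.2 hxy)]
  have : (dist (g x) (g y) / dist x y).toNNReal ≤ lipConst g := by
    refine le_csInf ⟨K, h⟩ fun K' hK' => Real.toNNReal_le_iff_le_coe.2 ?_
    exact (div_le_iff₀ (dist_pos.2 hxy)).2 (LipschitzWith.dist_le_mul hK' x y)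
  exact Real.toNNReal_le_iff_le_coe.1 this

theorem lipConst_le {d : ℕ} {g : E d → E d} {K : ℝ} (hK : 0 ≤ K)
    (h : ∀ x y, dist (g y) (g x) ≤ K * ‖y - x‖) : (lipConst g : ℝ) ≤ K := by
  have : lipConst g ≤ K.toNNReal := csInf_le (OrderBot.bddBelow _)
    (LipschitzWith.of_dist_le_mul fun x y => by
      rw [dist_eq_norm x y, Real.coe_toNNReal _ hK]; exact h y x)
  rwa [← NNReal.coe_le_coe, Real.coe_toNNReal _ hK] at this

theorem IsBVGMax.lipschitzWith_gradient {d : ℕ} (hd : 0 < d) {f : E d → ℝ} {γ : E d → E d}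
    {r L : ℝ} (h : IsBVGMax f γ r L) (hr : 0 < r) (hγ : IsSubgradientSelection f γ) :
    LipschitzWith (smoothness f r) (meanSubgradient γ r) := by
  have hL := h.2.1
  rw [smoothness, h.gradient_smoothed hd hr hγ]
  refine lipschitzWith_lipConst (K := ⟨9 / 2 * √d * L / r, by positivity⟩)
    (LipschitzWith.of_dist_le_mul fun x y => ?_)
  rw [dist_eq_norm x y]
  exact h.dist_meanSubgradient_le hd hr hγ.1 y x

theorem IsBVGMax.smoothness_le {d : ℕ} (hd : 0 < d) {f : E d → ℝ} {γ : E d → E d}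
    {r L : ℝ} (h : IsBVGMax f γ r L) (hr : 0 < r) (hγ : IsSubgradientSelection f γ) :
    (smoothness f r : ℝ) ≤ 9 / 2 * √d * L / r := by
  have hL := h.2.1
  rw [smoothness, h.gradient_smoothed hd hr hγ]
  exact lipConst_le (by positivity) (h.dist_meanSubgradient_le hd hr hγ.1)

/-! ### Polar coordinates and the sphere averages -/

theorem lintegral_eq_lintegral_sphere {d : ℕ} (hd : 0 < d) {F : E d → ENNReal}
    (hF : Measurable F) :
    ∫⁻ u, F u = ∫⁻ t : Ioi (0 : ℝ), ∫⁻ θ : Metric.sphere (0 : E d) 1, F ((t : ℝ) • (θ : E d))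
      ∂(volume : Measure (E d)).toSphere ∂Measure.volumeIoiPow (d - 1) := by
  have : Nonempty (Fin d) := ⟨⟨0, hd⟩⟩
  have hmp := (volume : Measure (E d)).measurePreserving_homeomorphUnitSphereProd
  rw [finrank_euclideanSpace_fin] at hmp
  have hm : Measurable fun p : Metric.sphere (0 : E d) 1 × Ioi (0 : ℝ) =>
      F ((p.2 : ℝ) • (p.1 : E d)) := by fun_prop
  rw [← lintegral_prod_symm _ hm.aemeasurable, ← hmp.lintegral_comp hm]
  have h1 : ∀ x : ({(0 : E d)}ᶜ : Set (E d)), F (((homeomorphUnitSphereProd (E d) x).2 : ℝ) •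
      ((homeomorphUnitSphereProd (E d) x).1 : E d)) = F x := fun x => by
    have := congrArg Subtype.val ((homeomorphUnitSphereProd (E d)).symm_apply_apply x)
    rw [homeomorphUnitSphereProd_symm_apply_coe] at this
    rw [this]
  simp only [h1]
  rw [lintegral_subtype_comap (measurableSet_singleton _).compl, restrict_compl_singleton]

theorem lintegral_le_of_sphere_le {d : ℕ} (hd : 0 < d) {F H : E d → ENNReal}
    (hF : Measurable F) (hH : Measurable H)
    (h : ∀ t : ℝ, 0 < t → ∫⁻ θ : Metric.sphere (0 : E d) 1, F (t • (θ : E d))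
      ∂(volume : Measure (E d)).toSphere ≤ ∫⁻ θ : Metric.sphere (0 : E d) 1, H (t • (θ : E d))
      ∂(volume : Measure (E d)).toSphere) : ∫⁻ u, F u ≤ ∫⁻ u, H u := by
  rw [lintegral_eq_lintegral_sphere hd hF, lintegral_eq_lintegral_sphere hd hH]
  exact lintegral_mono fun t => h t t.2

/-- The points of the unit ball of norm greater than `s`. -/
def ballShell (d : ℕ) (s : ℝ) : Set (E d) := {u | s < ‖u‖ ∧ ‖u‖ ≤ 1}

theorem measurableSet_ballShell (d : ℕ) (s : ℝ) : MeasurableSet (ballShell d s) :=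
  (measurableSet_lt measurable_const measurable_norm).inter
    (measurableSet_le measurable_norm measurable_const)

theorem ballShell_subset (d : ℕ) (s : ℝ) : ballShell d s ⊆ Metric.closedBall (0 : E d) 1 :=
  fun _ hu => mem_closedBall_zero_iff.2 hu.2

/-- In polar coordinates a bound on the averages over spheres integrates to one over any shell. The
bound `M` serves integrability only. -/
theorem setIntegral_ballShell_le {d : ℕ} (hd : 0 < d) {g : E d → ℝ} (hg : Measurable g)
    (hg0 : ∀ u, 0 ≤ g u) {M : ℝ} (hM : ∀ u, ‖u‖ ≤ 1 → g u ≤ M) {L : ℝ} (hL : 0 ≤ L)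
    (h : ∀ t : ℝ, 0 < t → t ≤ 1 → (⨍ θ : Metric.sphere (0 : E d) 1, g (t • (θ : E d))
      ∂(volume : Measure (E d)).toSphere) ≤ L) (s : ℝ) :
    ∫ u in ballShell d s, g u ≤ L * volume.real (ballShell d s) := by
  have hfin : volume (ballShell d s) ≠ ⊤ :=
    ((measure_mono (ballShell_subset d s)).trans_lt measure_closedBall_lt_top).ne
  have hA := measurableSet_ballShell d s
  have : Nonempty (Fin d) := ⟨⟨0, hd⟩⟩
  set σ := (volume : Measure (E d)).toSphere with hσ
  have key : ∫⁻ u in ballShell d s, ENNReal.ofReal (g u) ≤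
      ∫⁻ u in ballShell d s, ENNReal.ofReal L := by
    rw [← lintegral_indicator hA, ← lintegral_indicator hA]
    refine lintegral_le_of_sphere_le hd ((by fun_prop : Measurable fun u =>
      ENNReal.ofReal (g u)).indicator hA) (measurable_const.indicator hA) fun t ht => ?_
    have hn : ∀ θ : Metric.sphere (0 : E d) 1, ‖t • (θ : E d)‖ = t := fun θ => by
      rw [norm_smul, Real.norm_eq_abs, abs_of_pos ht, norm_eq_of_mem_sphere, mul_one]
    by_cases hts : s < t ∧ t ≤ 1
    · have hmem : ∀ θ : Metric.sphere (0 : E d) 1, t • (θ : E d) ∈ ballShell d s := fun θ => by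
        change s < ‖t • (θ : E d)‖ ∧ ‖t • (θ : E d)‖ ≤ 1
        rw [hn]; exact hts
      simp only [indicator_of_mem (hmem _)]
      have hi : Integrable (fun θ : Metric.sphere (0 : E d) 1 => g (t • (θ : E d))) σ := by
        refine Integrable.of_bound (Measurable.aestronglyMeasurable (by fun_prop)) M
          (Filter.Eventually.of_forall fun θ => ?_)
        rw [Real.norm_eq_abs, abs_of_nonneg (hg0 _)]
        exact hM _ (by rw [hn]; exact hts.2)
      rw [← ofReal_integral_eq_lintegral_ofReal hi (Filter.Eventually.of_forall fun θ => hg0 _),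
        lintegral_const, ← ofReal_measureReal (measure_ne_top _ _), ← ENNReal.ofReal_mul hL]
      refine ENNReal.ofReal_le_ofReal ?_
      have h1 := h t ht hts.2
      have hpos : 0 < σ.real univ := by
        rw [hσ, measureReal_def]
        exact ENNReal.toReal_pos (by simp [hd.ne', (Metric.measure_ball_pos _ _ one_pos).ne']) (measure_ne_top _ _)
      rw [average_eq, smul_eq_mul, inv_mul_le_iff₀ hpos] at h1
      linarith
    · have hmem : ∀ θ : Metric.sphere (0 : E d) 1, t • (θ : E d) ∉ ballShell d s := fun θ hθ => by
        change s < ‖t • (θ : E d)‖ ∧ ‖t • (θ : E d)‖ ≤ 1 at hθ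
        rw [hn] at hθ; exact hts hθ
      simp only [indicator_of_notMem (hmem _), le_refl]
  have hi : IntegrableOn g (ballShell d s) := by
    refine Measure.integrableOn_of_bounded (M := M) hfin hg.aestronglyMeasurable ?_
    filter_upwards [ae_restrict_mem hA] with u hu
    rw [Real.norm_eq_abs, abs_of_nonneg (hg0 _)]
    exact hM _ hu.2
  rw [← ofReal_integral_eq_lintegral_ofReal hi (Filter.Eventually.of_forall fun θ => hg0 _),
    setLIntegral_const, ← ofReal_measureReal hfin, ← ENNReal.ofReal_mul hL] at key
  exact (ENNReal.ofReal_le_ofReal_iff (by positivity)).1 key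

/-- Bernoulli's inequality: `1 - s^d ≤ d (1 - s)`. -/
theorem volume_ballShell_le {d : ℕ} {s : ℝ} (hs : 0 ≤ s) (hs1 : s ≤ 1) :
    volume.real (ballShell d s) ≤ d * (1 - s) * volume.real (Metric.closedBall (0 : E d) 1) := by
  have hsub : Metric.closedBall (0 : E d) s ⊆ Metric.closedBall 0 1 :=
    Metric.closedBall_subset_closedBall hs1
  have h1 : ballShell d s = Metric.closedBall (0 : E d) 1 \ Metric.closedBall 0 s := by
    ext u
    simp only [ballShell, mem_ofPred_eq, mem_sdiff, mem_closedBall_zero_iff, not_le]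
    exact and_comm
  rw [h1, measureReal_sdiff hsub measurableSet_closedBall (volume_closedBall_ne_top _ _),
    Measure.addHaar_real_closedBall' _ _ hs, finrank_euclideanSpace_fin]
  have h2 := one_add_mul_le_pow (a := s - 1) (by linarith) d
  rw [add_sub_cancel] at h2
  nlinarith [volume_closedBall_pos d]

theorem IsBVGAvg.nonneg {d : ℕ} {f : E d → ℝ} {γ : E d → E d} {r L : ℝ}
    (h : IsBVGAvg f γ r L) (hr : 0 < r) : 0 ≤ L := by
  refine le_trans ?_ (h.2 r hr le_rfl 0)
  rw [average_eq]
  exact smul_nonneg (by positivity) (integral_nonneg fun _ => norm_nonneg _)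

theorem IsBVGAvg.setIntegral_ballShell_le {d : ℕ} (hd : 0 < d) {f : E d → ℝ} {γ : E d → E d}
    {r L Lhat : ℝ} (h : IsBVGAvg f γ r L) (hm : IsBVGMax f γ r Lhat) (hr : 0 < r)
    (hγ : IsSubgradientSelection f γ) (x : E d) (s : ℝ) :
    ∫ u in ballShell d s, ‖γ (x + r • u) - meanSubgradient γ r x‖ ≤
      L * volume.real (ballShell d s) := by
  have hγm := hγ.1
  obtain ⟨M, hM⟩ := hm.norm_le hr (‖x‖ + r)
  refine _root_.setIntegral_ballShell_le hd (by fun_prop) (fun _ => norm_nonneg _)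
    (M := M + ‖meanSubgradient γ r x‖) (fun u hu => ?_) (h.nonneg hr) (fun t ht ht1 => ?_) s
  · refine (norm_sub_le _ _).trans ?_
    gcongr
    exact hM _ (norm_add_smul_le hr hu)
  · have := h.2 (r * t) (by positivity) (mul_le_of_le_one_right hr.le ht1) x
    rw [hm.gradient_smoothed hd hr hγ] at this
    simpa only [smul_smul] using this

theorem IsBVGAvg.integral_norm_le {d : ℕ} (hd : 0 < d) {f : E d → ℝ} {γ : E d → E d}
    {r L Lhat : ℝ} (h : IsBVGAvg f γ r L) (hm : IsBVGMax f γ r Lhat) (hr : 0 < r)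
    (hγ : IsSubgradientSelection f γ) (x : E d) :
    ∫ u, ‖γ (x + r • u) - meanSubgradient γ r x‖ ∂unifBall d ≤ L := by
  -- With a negative inner radius the shell is the whole ball, centre included.
  have h1 := h.setIntegral_ballShell_le hd hm hr hγ x (-1)
  have h2 : ballShell d (-1) = Metric.closedBall 0 1 := by
    ext u
    simp only [ballShell, mem_ofPred_eq, mem_closedBall_zero_iff, and_iff_right_iff_imp]
    intro _
    linarith [norm_nonneg u]
  rw [h2] at h1
  rw [integral_unifBall, smul_eq_mul, inv_mul_le_iff₀ (volume_closedBall_pos d)]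
  linarith

theorem IsBVGMax.norm_sub_meanSubgradient_le {d : ℕ} {f : E d → ℝ} {γ : E d → E d}
    {r Lhat : ℝ} (hm : IsBVGMax f γ r Lhat) (hr : 0 < r) (hγ : Measurable γ) (x c : E d) {K : ℝ}
    (hc : ∀ u, ‖u‖ ≤ 1 → ‖γ (x + r • u) - c‖ ≤ K) : ‖meanSubgradient γ r x - c‖ ≤ K := by
  have h1 : meanSubgradient γ r x - c = ∫ u, (γ (x + r • u) - c) ∂unifBall d := by
    rw [integral_sub (hm.integrable hr hγ hr x) (integrable_const _), integral_const]
    simp [meanSubgradient]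
  rw [h1]
  simpa using norm_integral_le_of_norm_le_const (ae_unifBall hc)

theorem IsBVGMax.exists_isBVGAvg {d : ℕ} (hd : 0 < d) {f : E d → ℝ} {γ : E d → E d}
    {r Lhat : ℝ} (hm : IsBVGMax f γ r Lhat) (hr : 0 < r) (hγ : IsSubgradientSelection f γ) :
    ∃ L, IsBVGAvg f γ r L := by
  refine ⟨2 * Lhat, hm.1, fun ρ hρ hρr x => ?_⟩
  have hL := hm.2.1
  rw [hm.gradient_smoothed hd hr hγ]
  set σ := (volume : Measure (E d)).toSphere with hσ
  have hb : ∀ θ : Metric.sphere (0 : E d) 1,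
      ‖γ (x + ρ • (θ : E d)) - meanSubgradient γ r x‖ ≤ 2 * Lhat := fun θ => by
    have h1 : ‖γ (x + ρ • (θ : E d)) - γ x‖ ≤ Lhat := hm.norm_sub_le hr (by
      rw [add_sub_cancel_left, norm_smul, Real.norm_eq_abs, abs_of_pos hρ, norm_eq_of_mem_sphere,
        mul_one]; exact hρr)
    have h2 := hm.norm_sub_meanSubgradient_le hr hγ.1 x (γ x)
      (fun u hu => hm.2.2 x u (mem_closedBall_zero_iff.2 hu))
    calc _ ≤ ‖γ (x + ρ • (θ : E d)) - γ x‖ + ‖γ x - meanSubgradient γ r x‖ :=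
          norm_sub_le_norm_sub_add_norm_sub ..
      _ ≤ 2 * Lhat := by rw [norm_sub_rev (γ x)]; linarith
  have h3 := norm_integral_le_of_norm_le_const (μ := σ) (C := 2 * Lhat)
    (f := fun θ : Metric.sphere (0 : E d) 1 => ‖γ (x + ρ • (θ : E d)) - meanSubgradient γ r x‖)
    (Filter.Eventually.of_forall fun θ => by rw [norm_norm]; exact hb θ)
  have h4 := (le_abs_self _).trans h3
  rw [average_eq, smul_eq_mul]
  rcases (measureReal_nonneg (μ := σ) (s := univ)).eq_or_lt with h0 | h0
  · rw [← h0]; simp; positivity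
  · rw [inv_mul_le_iff₀ h0]; linarith

/-- Both halves of the symmetric difference lie in shells of thickness `‖v‖`, one about `x` and one
about `y`. Recentring the second from the mean at `x` to the mean at `y` costs the unknown distance
`D` itself, times the volume of the shell, which is at most half that of the ball. Hence this term
is absorbed on the left. -/
theorem IsBVGAvg.dist_meanSubgradient_le {d : ℕ} (hd : 0 < d) {f : E d → ℝ} {γ : E d → E d}
    {r L Lhat : ℝ} (h : IsBVGAvg f γ r L) (hm : IsBVGMax f γ r Lhat) (hr : 0 < r)
    (hγ : IsSubgradientSelection f γ) (x y : E d) :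
    dist (meanSubgradient γ r y) (meanSubgradient γ r x) ≤ 4 * d * L / r * ‖y - x‖ := by
  have hd1 : (1 : ℝ) ≤ d := by exact_mod_cast hd
  -- This `δ` gives `d ‖v‖ ≤ 1/2`, which makes the absorption possible.
  refine dist_le_of_uniform_local (δ := r / (2 * d)) (by positivity) (fun x y hxy => ?_) x y
  set v : E d := r⁻¹ • (y - x) with hv
  have hy : y = x + r • v := by rw [hv, smul_smul, mul_inv_cancel₀ hr.ne', one_smul, add_sub_cancel]
  have hvn : ‖v‖ = ‖y - x‖ / r := by
    rw [hv, norm_smul, norm_inv, Real.norm_eq_abs, abs_of_pos hr]; ring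
  have hvs : d * ‖v‖ ≤ 1 / 2 := by
    rw [le_div_iff₀ (by positivity)] at hxy
    rw [hvn, mul_div_assoc', div_le_iff₀ hr]; linarith
  have hv1 : ‖v‖ ≤ 1 := by nlinarith [norm_nonneg v]
  set B := Metric.closedBall (0 : E d) 1 with hB
  set B' := Metric.closedBall v 1 with hB'
  set V := volume.real B with hVdef
  have hV : 0 < V := volume_closedBall_pos d
  set S := ballShell d (1 - ‖v‖) with hS
  set D := ‖meanSubgradient γ r y - meanSubgradient γ r x‖ with hD
  have hvolS : volume.real S ≤ d * ‖v‖ * V := by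
    have := volume_ballShell_le (d := d) (s := 1 - ‖v‖) (by linarith) (by linarith [norm_nonneg v])
    rwa [sub_sub_cancel] at this
  have hSfin : volume S ≠ ⊤ :=
    ((measure_mono (ballShell_subset d _)).trans_lt measure_closedBall_lt_top).ne
  have hint : ∀ x c : E d, IntegrableOn (fun u => ‖γ (x + r • u) - c‖) S := fun x c =>
    ((integrableOn_comp_of_bounded hγ.1 (hm.norm_le hr) x c 0 r 1).mono_set
      (ballShell_subset d _)).norm
  have key := norm_meanSubgradient_sub_le hγ.1 (hm.norm_le hr) r x v (meanSubgradient γ r x)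
  rw [← hy] at key
  have i1 : ∫ u in B \ B', ‖γ (x + r • u) - meanSubgradient γ r x‖ ≤ L * volume.real S := by
    refine le_trans (setIntegral_mono_set (hint _ _)
      (Filter.Eventually.of_forall fun _ => norm_nonneg _) (LE.le.eventuallyLE ?_))
      (h.setIntegral_ballShell_le hd hm hr hγ x _)
    rintro u ⟨hu, hu'⟩
    refine ⟨?_, mem_closedBall_zero_iff.1 hu⟩
    rw [hB', mem_closedBall_iff_norm, not_le] at hu'
    linarith [norm_sub_le u v]
  have i2 : ∫ u in B' \ B, ‖γ (x + r • u) - meanSubgradient γ r x‖ ≤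
      L * volume.real S + D * volume.real S := by
    have e1 : ∫ u in B' \ B, ‖γ (x + r • u) - meanSubgradient γ r x‖ =
        ∫ u in (fun u => v + u) ⁻¹' (B' \ B), ‖γ (y + r • u) - meanSubgradient γ r x‖ := by
      have := (measurePreserving_add_left (volume : Measure (E d)) v).setIntegral_preimage_emb
        (MeasurableEquiv.addLeft v).measurableEmbedding
        (fun u => ‖γ (x + r • u) - meanSubgradient γ r x‖) (B' \ B)
      rw [← this, hy]
      simp only [smul_add, add_assoc]
    rw [e1]
    have hsub : (fun u => v + u) ⁻¹' (B' \ B) ⊆ S := by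
      rintro u ⟨hu, hu'⟩
      rw [hB', mem_closedBall_iff_norm, add_sub_cancel_left] at hu
      rw [hB, mem_closedBall_zero_iff, not_le] at hu'
      exact ⟨by linarith [norm_add_le v u], hu⟩
    refine le_trans (setIntegral_mono_set (hint _ _)
      (Filter.Eventually.of_forall fun _ => norm_nonneg _) (LE.le.eventuallyLE hsub)) ?_
    have h1 : ∫ u in S, ‖γ (y + r • u) - meanSubgradient γ r x‖ ≤
        ∫ u in S, (‖γ (y + r • u) - meanSubgradient γ r y‖ + D) :=
      integral_mono (hint _ _) ((hint _ _).add (integrableOn_const hSfin))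
        fun u => norm_sub_le_norm_sub_add_norm_sub ..
    rw [integral_add (hint _ _) (integrableOn_const hSfin), setIntegral_const, smul_eq_mul] at h1
    linarith [h.setIntegral_ballShell_le hd hm hr hγ y (1 - ‖v‖)]
  have hL := h.nonneg hr
  have hD0 : 0 ≤ D := norm_nonneg _
  have e : 4 * d * L / r * ‖y - x‖ = 4 * (d * ‖v‖) * L := by rw [hvn]; ring
  rw [dist_eq_norm, ← hD, e]
  refine le_of_mul_le_mul_left (a := V) ?_ hV
  have j1 := mul_le_mul_of_nonneg_left hvolS hL
  have j2 := mul_le_mul_of_nonneg_left hvolS hD0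
  have j3 : D * (d * ‖v‖ * V) ≤ D * (1 / 2 * V) := by gcongr
  linarith

theorem IsBVGAvg.smoothness_le {d : ℕ} (hd : 0 < d) {f : E d → ℝ} {γ : E d → E d}
    {r L Lhat : ℝ} (h : IsBVGAvg f γ r L) (hm : IsBVGMax f γ r Lhat) (hr : 0 < r)
    (hγ : IsSubgradientSelection f γ) : (smoothness f r : ℝ) ≤ 4 * d * L / r := by
  have hL := h.nonneg hr
  rw [smoothness, hm.gradient_smoothed hd hr hγ]
  exact lipConst_le (by positivity) (h.dist_meanSubgradient_le hd hm hr hγ)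

/-! ### Dependence of the smoothing gap on the radius -/

/-- Convexity along the segment from `x` to `x + ρ' u`, averaged over `u`. -/
theorem smoothed_sub_le_mul {d : ℕ} {f : E d → ℝ} (hc : ConvexOn ℝ univ f) (hf : Continuous f)
    {ρ ρ' : ℝ} (hρ : 0 < ρ) (h : ρ ≤ ρ') (x : E d) :
    smoothed f ρ x - f x ≤ ρ / ρ' * (smoothed f ρ' x - f x) := by
  have hρ' : 0 < ρ' := hρ.trans_le h
  rw [smoothed_eq f hρ, smoothed_eq f hρ']
  have hi := integrable_comp_unifBall hf ρ x
  have hi' := integrable_comp_unifBall hf ρ' x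
  have h1 : ∫ u, f (x + ρ • u) ∂unifBall d ≤
      ∫ u, (ρ / ρ' * f (x + ρ' • u) + (1 - ρ / ρ') * f x) ∂unifBall d := by
    refine integral_mono hi ((hi'.const_mul _).add (integrable_const _)) fun u => ?_
    have hle : ρ / ρ' ≤ 1 := (div_le_one hρ').2 h
    have := hc.2 (mem_univ (x + ρ' • u)) (mem_univ x) (by positivity : 0 ≤ ρ / ρ')
      (by linarith : 0 ≤ 1 - ρ / ρ') (by ring)
    simp only [smul_eq_mul] at this
    convert this using 2
    rw [smul_add, smul_smul, div_mul_cancel₀ _ hρ'.ne']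
    module
  rw [integral_add (hi'.const_mul _) (integrable_const _), integral_const_mul, integral_const] at h1
  simp only [probReal_univ, smul_eq_mul, one_mul] at h1
  linarith

theorem smoothed_le_add {d : ℕ} {f : E d → ℝ} {γ : E d → E d} (hf : Continuous f)
    (hγ : IsSubgradientSelection f γ) {R M : ℝ} {x : E d} (hM : ∀ y, ‖y‖ ≤ ‖x‖ + R → ‖γ y‖ ≤ M)
    {ρ ρ' : ℝ} (hρ : 0 < ρ) (h : ρ ≤ ρ') (hR : ρ' ≤ R) :
    smoothed f ρ' x ≤ smoothed f ρ x + M * (ρ' - ρ) := by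
  have hρ' : 0 < ρ' := hρ.trans_le h
  have hi := integrable_comp_unifBall hf ρ x
  have hi' := integrable_comp_unifBall hf ρ' x
  have h1 : ∫ u, f (x + ρ' • u) ∂unifBall d ≤
      ∫ u, (f (x + ρ • u) + M * (ρ' - ρ)) ∂unifBall d := by
    refine integral_mono_ae hi' (hi.add (integrable_const _)) (ae_unifBall fun u hu => ?_)
    have h2 := hγ.2 (x + ρ' • u) (x + ρ • u)
    have h3 : ‖γ (x + ρ' • u)‖ ≤ M := hM _ ((norm_add_smul_le hρ' hu).trans (by gcongr))
    have e : x + ρ • u - (x + ρ' • u) = -((ρ' - ρ) • u) := by module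
    have h4 : ⟪γ (x + ρ' • u), (ρ' - ρ) • u⟫ ≤ M * (ρ' - ρ) := by
      refine (real_inner_le_norm _ _).trans ?_
      rw [norm_smul, Real.norm_eq_abs, abs_of_nonneg (by linarith)]
      have : (ρ' - ρ) * ‖u‖ ≤ (ρ' - ρ) := mul_le_of_le_one_right (by linarith) hu
      have h0 : 0 ≤ ρ' - ρ := by linarith
      gcongr
      exact (norm_nonneg _).trans h3
    rw [e, inner_neg_right] at h2
    change f (x + ρ' • u) ≤ f (x + ρ • u) + M * (ρ' - ρ)
    linarith
  rw [integral_add hi (integrable_const _), integral_const] at h1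
  simp only [probReal_univ, smul_eq_mul, one_mul] at h1
  rw [smoothed_eq f hρ, smoothed_eq f hρ']
  exact h1

/-- A gap strictly below `ε / 2` would leave room for a larger radius, since the gap is locally
Lipschitz in the radius. -/
theorem le_smoothed_sub_of_isGreatest {d : ℕ} {f : E d → ℝ} {γ : E d → E d} (hf : Continuous f)
    (hγ : IsSubgradientSelection f γ) (hb : ∀ R, ∃ M, ∀ x : E d, ‖x‖ ≤ R → ‖γ x‖ ≤ M)
    {x : E d} {ε r : ℝ} (hr : IsGreatest (admissibleRadii f x ε) r) :
    ε / 2 ≤ smoothed f r x - f x := by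
  by_contra! hlt
  have hr0 : 0 < r := hr.1.1
  obtain ⟨M, hM⟩ := hb (‖x‖ + (r + 1))
  set g := ε / 2 - (smoothed f r x - f x) with hg
  have hg0 : 0 < g := by linarith
  have hM0 : 0 ≤ |M| := abs_nonneg M
  set δ := min 1 (g / (|M| + 1)) with hδ
  have hδ0 : 0 < δ := lt_min one_pos (by positivity)
  have h1 := smoothed_le_add hf hγ hM hr0 (by linarith : r ≤ r + δ)
    (by linarith [min_le_left 1 (g / (|M| + 1))])
  have h2 : M * (r + δ - r) ≤ g := by
    have h3 : δ * (|M| + 1) ≤ g := (le_div_iff₀ (by positivity)).1 (min_le_right _ _)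
    have h4 : M * δ ≤ |M| * δ := by gcongr; exact le_abs_self M
    rw [add_sub_cancel_left]
    linarith
  have : r + δ ≤ r := hr.2 ⟨by linarith, by linarith⟩
  linarith

/-- The increment `f (x + r u) - f x` is at most `r ⟪γ (x + r u), u⟫`. Subtracting the mean
subgradient from `γ` does not change the average, and leaves the mean oscillation. -/
theorem IsBVGAvg.smoothed_sub_le {d : ℕ} (hd : 0 < d) {f : E d → ℝ} {γ : E d → E d}
    {r L Lhat : ℝ} (h : IsBVGAvg f γ r L) (hm : IsBVGMax f γ r Lhat) (hr : 0 < r)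
    (hγ : IsSubgradientSelection f γ) (x : E d) : smoothed f r x - f x ≤ r * L := by
  have hi := hm.integrable hr hγ.1 hr x
  have hi' : Integrable (fun u => ‖γ (x + r • u) - meanSubgradient γ r x‖) (unifBall d) :=
    (hi.sub (integrable_const _)).norm
  have hin := (integrable_inner_unifBall (meanSubgradient γ r x)).const_mul r
  have hin' : Integrable (fun u => f x + r * ⟪meanSubgradient γ r x, u⟫) (unifBall d) :=
    (integrable_const _).add hin
  have h1 : ∫ u, f (x + r • u) ∂unifBall d ≤ ∫ u, (f x + r * ⟪meanSubgradient γ r x, u⟫ +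
      r * ‖γ (x + r • u) - meanSubgradient γ r x‖) ∂unifBall d := by
    refine integral_mono_ae (integrable_comp_unifBall hm.1.continuous r x)
      (hin'.add (hi'.const_mul r)) (ae_unifBall fun u hu => ?_)
    have h2 := hγ.2 (x + r • u) x
    rw [sub_add_cancel_left, inner_neg_right, real_inner_smul_right] at h2
    have h3 : ⟪γ (x + r • u) - meanSubgradient γ r x, u⟫ ≤
        ‖γ (x + r • u) - meanSubgradient γ r x‖ :=
      (real_inner_le_norm _ _).trans (mul_le_of_le_one_right (norm_nonneg _) hu)
    rw [inner_sub_left] at h3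
    have h4 := mul_le_mul_of_nonneg_left h3 hr.le
    change f (x + r • u) ≤ f x + r * ⟪meanSubgradient γ r x, u⟫ +
      r * ‖γ (x + r • u) - meanSubgradient γ r x‖
    linarith
  rw [integral_add hin' (hi'.const_mul r),
    integral_add (integrable_const _) hin, integral_const_mul, integral_const_mul,
    integral_inner_unifBall, integral_const] at h1
  simp only [probReal_univ, smul_eq_mul, one_mul, mul_zero, add_zero] at h1
  have h5 := mul_le_mul_of_nonneg_left (h.integral_norm_le hd hm hr hγ x) hr.le
  rw [smoothed_eq f hr]
  linarith

/-- The difference of `f` and its affine minorant at `x` is continuous, nonnegative and of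
nonpositive mean on every ball about `x`, hence zero. -/
theorem affine_of_smoothed_eq {d : ℕ} {f : E d → ℝ} {γ : E d → E d} (hf : Continuous f)
    (hγ : IsSubgradientSelection f γ) {x : E d} (h : ∀ ρ, 0 < ρ → smoothed f ρ x ≤ f x) (y : E d) :
    f y = f x + ⟪γ x, y - x⟫ := by
  set ρ := ‖y - x‖ + 1 with hρ
  have hρ0 : 0 < ρ := by positivity
  set g : E d → ℝ := fun u => f (x + ρ • u) - (f x + ρ * ⟪γ x, u⟫) with hg
  have hg0 : ∀ u, 0 ≤ g u := fun u => by
    have := hγ.2 x (x + ρ • u)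
    rw [add_sub_cancel_left, real_inner_smul_right] at this
    exact sub_nonneg.2 this
  have hgc : Continuous g := by fun_prop
  have hgi : IntegrableOn g (Metric.closedBall 0 1) :=
    hgc.continuousOn.integrableOn_compact (isCompact_closedBall _ _)
  have hin := (integrable_inner_unifBall (γ x)).const_mul ρ
  have hin' : Integrable (fun u => f x + ρ * ⟪γ x, u⟫) (unifBall d) :=
    (integrable_const _).add hin
  have hint : ∫ u, g u ∂unifBall d ≤ 0 := by
    rw [hg, integral_sub (integrable_comp_unifBall hf ρ x) hin',
      integral_add (integrable_const _) hin, integral_const_mul, integral_inner_unifBall,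
      integral_const, ← smoothed_eq f hρ0]
    simpa using h ρ hρ0
  rw [integral_unifBall, smul_eq_mul, inv_mul_le_iff₀ (volume_closedBall_pos d), mul_zero] at hint
  have hae := (integral_eq_zero_iff_of_nonneg hg0 hgi).1
    (le_antisymm hint (integral_nonneg hg0))
  have hz : EqOn g 0 (Metric.closedBall 0 1) := by
    refine Measure.eqOn_of_ae_eq hae hgc.continuousOn continuousOn_const ?_
    rw [interior_closedBall _ one_ne_zero, closure_ball _ one_ne_zero]
  have hmem : ρ⁻¹ • (y - x) ∈ Metric.closedBall (0 : E d) 1 := by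
    rw [mem_closedBall_zero_iff, norm_smul, norm_inv, Real.norm_eq_abs, abs_of_pos hρ0,
      inv_mul_le_iff₀ hρ0]
    linarith
  have := hz hmem
  simp only [hg, smul_smul, mul_inv_cancel₀ hρ0.ne', one_smul, add_sub_cancel,
    real_inner_smul_right, ← mul_assoc, one_mul, Pi.zero_apply] at this
  linarith

theorem smoothness_eq_zero_of_affine {d : ℕ} {f : E d → ℝ} {x v : E d}
    (h : ∀ y, f y = f x + ⟪v, y - x⟫) {ρ : ℝ} (hρ : 0 < ρ) : smoothness f ρ = 0 := by
  have h1 : ∀ y, smoothed f ρ y = f y := fun y => by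
    rw [smoothed_eq f hρ]
    have h2 : ∀ u, f (y + ρ • u) = f y + ρ * ⟪v, u⟫ := fun u => by
      rw [h, h y, add_sub_right_comm, inner_add_right, real_inner_smul_right]; ring
    simp only [h2]
    rw [integral_add (integrable_const _) ((integrable_inner_unifBall _).const_mul _),
      integral_const_mul, integral_inner_unifBall]
    simp
  have h3 : ∀ y, gradient (smoothed f ρ) y = v := fun y =>
    (hasGradientAt_of_lipschitz_subgradient (K := 0) (G := fun _ => v) (LipschitzWith.const v)
      (fun a b => by
        rw [h1, h1, h a, h b, add_assoc, ← inner_add_right]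
        apply le_of_eq; congr 2; abel) y).gradient
  have : (smoothness f ρ : ℝ) ≤ 0 := lipConst_le le_rfl fun a b => by rw [h3, h3]; simp
  exact le_antisymm (by exact_mod_cast this) zero_le

theorem exists_isGreatest_admissibleRadii {d : ℕ} {f : E d → ℝ} {γ : E d → E d}
    (hc : ConvexOn ℝ univ f) (hf : Continuous f) (hγ : IsSubgradientSelection f γ)
    (hb : ∀ R, ∃ M, ∀ x : E d, ‖x‖ ≤ R → ‖γ x‖ ≤ M) (x : E d) {ε : ℝ} (hε : 0 < ε) :
    (∃ r, IsGreatest (admissibleRadii f x ε) r) ∨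
      ∀ ρ : ℝ, 0 < ρ → ρ ∈ admissibleRadii f x ε ∧ smoothness f ρ = 0 := by
  have hnn : ∀ ρ, 0 < ρ → 0 ≤ smoothed f ρ x - f x := fun ρ hρ =>
    sub_nonneg.2 (le_smoothed hf hγ hρ x)
  by_cases hall : ∀ ρ : ℝ, 0 < ρ → ρ ∈ admissibleRadii f x ε
  · right
    have hz : ∀ ρ, 0 < ρ → smoothed f ρ x ≤ f x := fun ρ hρ => by
      by_contra! hlt
      set g := smoothed f ρ x - f x with hg
      have hg0 : 0 < g := by linarith
      -- A gap `g > 0` grows at least linearly with the radius, so at this radius it would be at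
      -- least `g + ε`, which is not admissible.
      have hle : ρ ≤ ρ * (1 + ε / g) := le_mul_of_one_le_right hρ.le
        (by have : 0 < ε / g := by positivity
            linarith)
      have h1 := smoothed_sub_le_mul hc hf hρ hle x
      have h2 := (hall (ρ * (1 + ε / g)) (by positivity)).2
      rw [div_mul_cancel_left₀ hρ.ne', ← hg, inv_mul_eq_div, le_div_iff₀ (by positivity), mul_add,
        mul_one, mul_div_cancel₀ _ hg0.ne'] at h1
      linarith
    exact fun ρ hρ => ⟨hall ρ hρ, smoothness_eq_zero_of_affine
      (affine_of_smoothed_eq hf hγ hz) hρ⟩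
  · left
    push Not at hall
    obtain ⟨R, hR, hRn⟩ := hall
    have hbd : ∀ ρ ∈ admissibleRadii f x ε, ρ ≤ R := fun ρ hρ => by
      by_contra! hlt
      refine hRn ⟨hR, ?_⟩
      have h1 := smoothed_sub_le_mul hc hf hR hlt.le x
      have h2 : R / ρ * (smoothed f ρ x - f x) ≤ smoothed f ρ x - f x :=
        mul_le_of_le_one_left (hnn ρ hρ.1) ((div_le_one hρ.1).2 hlt.le)
      linarith [hρ.2]
    have hBdd : BddAbove (admissibleRadii f x ε) := ⟨R, hbd⟩
    have hRg : ε / 2 < smoothed f R x - f x := by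
      by_contra! hle; exact hRn ⟨hR, hle⟩
    have hne : (admissibleRadii f x ε).Nonempty := by
      set g := smoothed f R x - f x with hg
      have hg0 : 0 < g := by linarith
      have hlt : ε / 2 / g ≤ 1 := (div_le_one hg0).2 hRg.le
      -- Shrinking `R` by the factor `(ε/2)/g` brings the gap `g` down to at most `ε / 2`.
      have h1 := smoothed_sub_le_mul hc hf (by positivity : 0 < ε / 2 / g * R)
        (mul_le_of_le_one_left hR.le hlt) x
      rw [mul_div_assoc, div_self hR.ne', mul_one, ← hg, div_mul_cancel₀ _ hg0.ne'] at h1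
      exact ⟨_, by positivity, h1⟩
    set r := sSup (admissibleRadii f x ε) with hr
    have hr0 : 0 < r := by
      obtain ⟨ρ, hρ⟩ := hne
      exact hρ.1.trans_le (le_csSup hBdd hρ)
    refine ⟨r, ⟨hr0, ?_⟩, fun ρ hρ => le_csSup hBdd hρ⟩
    obtain ⟨M, hM⟩ := hb (‖x‖ + r)
    refine le_of_forall_pos_le_add fun δ hδ => ?_
    have hM0 : 0 ≤ M := (norm_nonneg _).trans (hM x (by linarith))
    obtain ⟨ρ, hρ, hρr⟩ := exists_lt_of_lt_csSup hne
      (show r - δ / (M + 1) < r by have : 0 < δ / (M + 1) := by positivity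
                                   linarith)
    have h1 := smoothed_le_add hf hγ hM hρ.1 (le_csSup hBdd hρ) le_rfl
    have h2 : M * (r - ρ) ≤ δ := by
      have h3 : r - ρ ≤ δ / (M + 1) := by linarith
      rw [le_div_iff₀ (by positivity)] at h3
      nlinarith [le_csSup hBdd hρ]
    have h4 := hρ.2
    linarith

/-! ### Concentration on the unit ball and polytopes -/

theorem unifBall_real_le {d : ℕ} {A : Set (E d)} {c : E d} {ρ : ℝ}
    (hρ : 0 ≤ ρ) (h : ∀ u ∈ A, ‖u‖ ≤ 1 → ‖u - c‖ ≤ ρ) : (unifBall d).real A ≤ ρ ^ d := by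
  have h1 : (unifBall d).real A = (volume.real (Metric.closedBall (0 : E d) 1))⁻¹ *
      volume.real (Metric.closedBall (0 : E d) 1 ∩ A) := by
    rw [unifBall, measureReal_def, cond_apply measurableSet_closedBall, ENNReal.toReal_mul,
      ENNReal.toReal_inv]; rfl
  rw [h1, inv_mul_le_iff₀ (volume_closedBall_pos d)]
  have h2 : volume.real (Metric.closedBall (0 : E d) 1 ∩ A) ≤
      volume.real (Metric.closedBall c ρ) :=
    measureReal_mono (fun u hu => mem_closedBall_iff_norm.2
      (h u hu.2 (mem_closedBall_zero_iff.1 hu.1))) (volume_closedBall_ne_top _ _)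
  rw [Measure.addHaar_real_closedBall' _ _ hρ, finrank_euclideanSpace_fin] at h2
  linarith

/-- The cap lies in a ball about `(t/D²) w` whose squared radius is `1 - t²/D² ≤ exp (-t²/D²)`; the
volume ratio is the `d`-th power of the radius. -/
theorem unifBall_real_inner_ge_le {d : ℕ} {w : E d} {D t : ℝ} (hw : ‖w‖ ≤ D) (hD : 0 < D)
    (ht : 0 ≤ t) :
    (unifBall d).real {u | t ≤ ⟪w, u⟫} ≤ Real.exp (-(d * t ^ 2 / (2 * D ^ 2))) := by
  have h := unifBall_real_le (A := {u | t ≤ ⟪w, u⟫}) (c := (t / D ^ 2) • w)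
    (ρ := Real.exp (-(t ^ 2 / (2 * D ^ 2))))
    (Real.exp_nonneg _) (fun u hu hu1 => ?_)
  · refine h.trans_eq ?_
    rw [← Real.exp_nat_mul]; congr 1; ring
  · have h1 : ‖u - (t / D ^ 2) • w‖ ^ 2 ≤ 1 - t ^ 2 / D ^ 2 := by
      rw [norm_sub_sq_real, real_inner_smul_right, norm_smul, Real.norm_eq_abs,
        abs_of_nonneg (by positivity), real_inner_comm]
      have a1 : ‖u‖ ^ 2 ≤ 1 := by nlinarith [norm_nonneg u]
      have a2 : t / D ^ 2 * t ≤ t / D ^ 2 * ⟪w, u⟫ := by gcongr; exact hu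
      have a3 : (t / D ^ 2 * ‖w‖) ^ 2 ≤ (t / D ^ 2 * D) ^ 2 := by gcongr
      have a4 : (t / D ^ 2 * D) ^ 2 = t ^ 2 / D ^ 2 := by field_simp
      have a5 : t / D ^ 2 * t = t ^ 2 / D ^ 2 := by ring
      linarith
    have h2 : 1 - t ^ 2 / D ^ 2 ≤ Real.exp (-(t ^ 2 / (2 * D ^ 2))) ^ 2 := by
      rw [← Real.exp_nat_mul]
      have := Real.add_one_le_exp (-(t ^ 2 / D ^ 2))
      refine le_trans (by linarith) (this.trans_eq ?_)
      congr 1; field_simp; norm_num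
    exact (sq_le_sq₀ (norm_nonneg _) (Real.exp_nonneg _)).1 (h1.trans h2)

theorem integrable_inner_excess {d : ℕ} (w : E d) (t : ℝ) :
    Integrable (fun u => max (⟪w, u⟫ - t) 0) (unifBall d) :=
  ((integrable_inner_unifBall w).sub (integrable_const _)).pos_part

/-- Integrate the tail bound by the layer-cake formula, using `(t + s)² ≥ t² + 2 t s` to get an
exponential in `s`. -/
theorem integral_inner_excess_le {d : ℕ} (hd : 0 < d) {w : E d} {D t : ℝ} (hw : ‖w‖ ≤ D)
    (hD : 0 < D) (ht : 0 < t) :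
    ∫ u, max (⟪w, u⟫ - t) 0 ∂unifBall d ≤
      Real.exp (-(d * t ^ 2 / (2 * D ^ 2))) * (D ^ 2 / (d * t)) := by
  have hd0 : (0 : ℝ) < d := by exact_mod_cast hd
  rw [(integrable_inner_excess w t).integral_eq_integral_meas_lt
    (Filter.Eventually.of_forall fun _ => le_max_right _ _)]
  set b := d * t / D ^ 2 with hb
  have hb0 : 0 < b := by positivity
  have hexp : IntegrableOn (fun s : ℝ => Real.exp (-(d * t ^ 2 / (2 * D ^ 2))) * Real.exp (-b * s))
      (Ioi 0) := (integrableOn_exp_mul_Ioi (by linarith) 0).const_mul _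
  calc ∫ s in Ioi 0, (unifBall d).real {u | s < max (⟪w, u⟫ - t) 0}
      ≤ ∫ s in Ioi (0 : ℝ), Real.exp (-(d * t ^ 2 / (2 * D ^ 2))) * Real.exp (-b * s) := by
        refine integral_mono_of_nonneg (Filter.Eventually.of_forall fun _ => measureReal_nonneg)
          hexp ?_
        filter_upwards [ae_restrict_mem measurableSet_Ioi] with s hs
        rw [mem_Ioi] at hs
        have h1 : (unifBall d).real {u | s < max (⟪w, u⟫ - t) 0} ≤
            (unifBall d).real {u | t + s ≤ ⟪w, u⟫} := by
          refine measureReal_mono fun u hu => ?_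
          rcases lt_max_iff.1 (show s < max (⟪w, u⟫ - t) 0 from hu) with h | h
          · change t + s ≤ ⟪w, u⟫; linarith
          · linarith
        refine h1.trans ((unifBall_real_inner_ge_le hw hD (by linarith)).trans ?_)
        rw [← Real.exp_add]
        refine Real.exp_le_exp.2 ?_
        have e : d * (t + s) ^ 2 / (2 * D ^ 2) =
            d * t ^ 2 / (2 * D ^ 2) + b * s + d * s ^ 2 / (2 * D ^ 2) := by
          rw [hb]; field_simp; ring
        rw [e]
        have : 0 ≤ d * s ^ 2 / (2 * D ^ 2) := by positivity
        linarith
    _ = _ := by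
        rw [integral_const_mul, integral_exp_mul_Ioi (by linarith)]
        congr 1
        rw [mul_zero, Real.exp_zero, hb]
        field_simp

/-! ### Polytopes, the Goldstein subdifferential and the smoothing gap. -/

theorem IsPolytope.isCompact {d : ℕ} {K : Set (E d)} (hK : IsPolytope K) : IsCompact K := by
  obtain ⟨S, hS, rfl⟩ := hK
  exact hS.isCompact_convexHull ℝ

theorem IsPolytope.convex {d : ℕ} {K : Set (E d)} (hK : IsPolytope K) : Convex ℝ K := by
  obtain ⟨S, hS, rfl⟩ := hK
  exact convex_convexHull ℝ S

theorem IsPolytope.finite_extremePoints {d : ℕ} {K : Set (E d)} (hK : IsPolytope K) :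
    (K.extremePoints ℝ).Finite := by
  obtain ⟨S, hS, rfl⟩ := hK
  exact hS.subset extremePoints_convexHull_subset

theorem IsPolytope.convexHull_extremePoints {d : ℕ} {K : Set (E d)} (hK : IsPolytope K) :
    convexHull ℝ (K.extremePoints ℝ) = K := by
  rw [← (hK.finite_extremePoints.isClosed_convexHull ℝ).closure_eq,
    closure_convexHull_extremePoints hK.isCompact hK.convex]

/-- A linear function on the hull is bounded by its values at the points of `V`, and each of these
by `t` plus the sum of all excesses over `t`. The sum replaces a maximum, as in a union bound. -/
theorem inner_sub_le_of_mem_convexHull {d : ℕ} {V : Set (E d)} (hV : V.Finite) {y c u : E d}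
    (hy : y ∈ convexHull ℝ V) (t : ℝ) :
    ⟪y - c, u⟫ ≤ t + ∑ v ∈ hV.toFinset, max (⟪v - c, u⟫ - t) 0 := by
  set R := t + ∑ v ∈ hV.toFinset, max (⟪v - c, u⟫ - t) 0 with hR
  have hconv : Convex ℝ {y : E d | ⟪u, y⟫ ≤ R + ⟪u, c⟫} :=
    convex_halfSpace_le (innerSL ℝ u).toLinearMap.isLinear _
  have hsub : V ⊆ {y : E d | ⟪u, y⟫ ≤ R + ⟪u, c⟫} := fun v hv => by
    have h1 : max (⟪v - c, u⟫ - t) 0 ≤ ∑ v ∈ hV.toFinset, max (⟪v - c, u⟫ - t) 0 :=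
      Finset.single_le_sum (f := fun v => max (⟪v - c, u⟫ - t) 0) (fun _ _ => le_max_right _ _)
        (hV.mem_toFinset.2 hv)
    have h2 := le_max_left (⟪v - c, u⟫ - t) 0
    have h3 : ⟪v - c, u⟫ = ⟪u, v⟫ - ⟪u, c⟫ := by rw [real_inner_comm, inner_sub_right]
    change ⟪u, v⟫ ≤ R + ⟪u, c⟫
    linarith
  have h4 : ⟪u, y⟫ ≤ R + ⟪u, c⟫ := convexHull_min hsub hconv hy
  rw [real_inner_comm, inner_sub_right]
  linarith

theorem ae_differentiableAt_of_locallyLipschitz {d : ℕ} {f : E d → ℝ} (hf : LocallyLipschitz f) :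
    ∀ᵐ y : E d, DifferentiableAt ℝ f y := by
  have h : ∀ n : ℕ, ∀ᵐ y : E d, y ∈ Metric.closedBall (0 : E d) (n + 1) →
      DifferentiableWithinAt ℝ f (Metric.closedBall (0 : E d) (n + 1)) y := fun n => by
    obtain ⟨K, hK⟩ := (hf.locallyLipschitzOn).exists_lipschitzOnWith_of_compact
      (isCompact_closedBall (0 : E d) (n + 1))
    exact hK.ae_differentiableWithinAt_of_mem
  filter_upwards [ae_all_iff.2 h] with y hy
  obtain ⟨n, hn⟩ := exists_nat_ge ‖y‖
  refine (hy n (mem_closedBall_zero_iff.2 (by linarith))).differentiableAt ?_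
  refine Filter.mem_of_superset (Metric.isOpen_ball.mem_nhds ?_) Metric.ball_subset_closedBall
  exact mem_ball_zero_iff.2 (by linarith)

/-- The function `f - ⟪γ y, ·⟫` has a minimum at `y`, so its derivative vanishes there. -/
theorem IsSubgradientSelection.gradient_eq {d : ℕ} {f : E d → ℝ} {γ : E d → E d}
    (hγ : IsSubgradientSelection f γ) {y : E d} (hy : DifferentiableAt ℝ f y) :
    gradient f y = γ y := by
  have h1 : HasFDerivAt (fun z => f z - innerSL ℝ (γ y) z) (fderiv ℝ f y - innerSL ℝ (γ y)) y :=
    hy.hasFDerivAt.sub (innerSL ℝ (γ y)).hasFDerivAt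
  have hmin : IsLocalMin (fun z => f z - innerSL ℝ (γ y) z) y :=
    Filter.Eventually.of_forall fun z => by
      have := hγ.2 y z
      rw [inner_sub_right] at this
      change f y - ⟪γ y, y⟫ ≤ f z - ⟪γ y, z⟫
      linarith
  have h2 := hmin.hasFDerivAt_eq_zero h1
  have h3 : HasGradientAt f (γ y) y := by
    have := hy.hasFDerivAt
    rw [sub_eq_zero.1 h2] at this
    exact this
  exact h3.gradient

theorem ae_mem_goldstein {d : ℕ} {f : E d → ℝ} {γ : E d → E d} (hf : LocallyLipschitz f)
    (hγ : IsSubgradientSelection f γ) {r : ℝ} (hr : 0 < r) (x : E d) :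
    ∀ᵐ u ∂unifBall d, γ (x + r • u) ∈ goldstein f r x := by
  have hq := (measurePreserving_add_left (volume : Measure (E d)) x).quasiMeasurePreserving.comp
    (Measure.quasiMeasurePreserving_smul (volume : Measure (E d)) hr.ne')
  have h1 := cond_absolutelyContinuous (s := Metric.closedBall (0 : E d) 1).ae_le
    (hq.ae (ae_differentiableAt_of_locallyLipschitz hf))
  have h2 : ∀ᵐ u ∂unifBall d, ‖u‖ ≤ 1 := ae_unifBall fun _ h => h
  filter_upwards [h1, h2] with u hu hu1
  refine subset_convexHull ℝ _ ⟨x + r • u, ⟨?_, hu⟩, hγ.gradient_eq hu⟩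
  rw [mem_closedBall_iff_norm, add_sub_cancel_left, norm_smul, Real.norm_eq_abs, abs_of_pos hr]
  exact mul_le_of_le_one_right hr.le hu1

theorem smoothed_sub_le_of_inner_le {d : ℕ} {f : E d → ℝ} {γ : E d → E d} (hf : Continuous f)
    (hγ : IsSubgradientSelection f γ) {r : ℝ} (hr : 0 < r) (x c : E d) {h : E d → ℝ}
    (hh : Integrable h (unifBall d)) (hle : ∀ᵐ u ∂unifBall d, ⟪γ (x + r • u) - c, u⟫ ≤ h u) :
    smoothed f r x - f x ≤ r * ∫ u, h u ∂unifBall d := by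
  have hin := (integrable_inner_unifBall c).const_mul r
  have hin' : Integrable (fun u => f x + r * ⟪c, u⟫) (unifBall d) := (integrable_const _).add hin
  have h1 : ∫ u, f (x + r • u) ∂unifBall d ≤
      ∫ u, (f x + r * ⟪c, u⟫ + r * h u) ∂unifBall d := by
    refine integral_mono_ae (integrable_comp_unifBall hf r x) (hin'.add (hh.const_mul r)) ?_
    filter_upwards [hle] with u hu
    have h2 := hγ.2 (x + r • u) x
    rw [sub_add_cancel_left, inner_neg_right, real_inner_smul_right] at h2
    rw [inner_sub_left] at hu
    have h4 := mul_le_mul_of_nonneg_left hu hr.le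
    linarith
  rw [integral_add hin' (hh.const_mul r), integral_add (integrable_const _) hin,
    integral_const_mul, integral_const_mul, integral_inner_unifBall, integral_const] at h1
  simp only [probReal_univ, smul_eq_mul, one_mul, mul_zero, add_zero] at h1
  rw [smoothed_eq f hr]
  linarith

theorem smoothed_sub_le_of_polytope {d : ℕ} (hd : 0 < d) {f : E d → ℝ} {γ : E d → E d}
    (hf : LocallyLipschitz f) (hγ : IsSubgradientSelection f γ) {r : ℝ} (hr : 0 < r) (x : E d)
    {K : Set (E d)} (hK : IsPolytope K) (hGK : goldstein f r x ⊆ K) :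
    smoothed f r x - f x ≤
      r * (2 * (Metric.diam K * √(2 * Real.log (numVertices K) / d))) := by
  have hd0 : (0 : ℝ) < d := by exact_mod_cast hd
  have hae := ae_mem_goldstein hf hγ hr x
  have hne : K.Nonempty := by
    obtain ⟨u, hu⟩ := hae.exists
    exact ⟨_, hGK hu⟩
  set V := K.extremePoints ℝ with hV
  have hfin : V.Finite := hK.finite_extremePoints
  have hhull : convexHull ℝ V = K := hK.convexHull_extremePoints
  have hVne : V.Nonempty := by
    rw [← convexHull_nonempty_iff (𝕜 := ℝ), hhull]; exact hne
  obtain ⟨c, hc⟩ := hVne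
  have hcK : c ∈ K := hc.1
  -- With a single vertex `log N = 0` and the bound is zero. This case is separate because the
  -- choice of `t` below needs `log N > 0`.
  rcases V.subsingleton_or_nontrivial with hs | hs
  · have hVc : V = {c} := hs.eq_singleton_of_mem hc
    have hKc : K = {c} := by rw [← hhull, hVc, convexHull_singleton]
    have := smoothed_sub_le_of_inner_le hf.continuous hγ hr x c (h := fun _ => 0)
      (integrable_const _) (by
        filter_upwards [hae] with u hu
        have h1 := hGK hu
        rw [hKc, mem_singleton_iff] at h1
        rw [h1]; simp)
    rw [integral_zero, mul_zero] at this
    exact this.trans (by have := Metric.diam_nonneg (s := K); positivity)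
  · obtain ⟨c', hc', hcc'⟩ := hs.exists_ne c
    set D := Metric.diam K with hDdef
    have hD : 0 < D := (dist_pos.2 hcc').trans_le
      (Metric.dist_le_diam_of_mem hK.isCompact.isBounded hc'.1 hcK)
    have := hfin.to_subtype
    have hN : 2 ≤ numVertices K := one_lt_ncard_iff_nontrivial.2 hs
    set N : ℝ := (numVertices K : ℝ) with hNdef
    have hN2 : (2 : ℝ) ≤ N := by rw [hNdef]; exact_mod_cast hN
    have hlog : 1 / 2 < Real.log N :=
      lt_of_lt_of_le (by linarith [Real.log_two_gt_d9]) (Real.log_le_log two_pos hN2)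
    -- At this level the tail of each vertex is `1/N`, so the `N` excesses together contribute at
    -- most `D²/(d t)`, which is at most `t` because `2 log N ≥ 1`.
    set t := D * √(2 * Real.log N / d) with ht
    have ht0 : 0 < t := by positivity
    have htsq : t ^ 2 = D ^ 2 * (2 * Real.log N / d) := by
      rw [ht, mul_pow, Real.sq_sqrt (by positivity)]
    have hexp : Real.exp (-(d * t ^ 2 / (2 * D ^ 2))) = N⁻¹ := by
      have e : d * t ^ 2 / (2 * D ^ 2) = Real.log N := by rw [htsq]; field_simp
      rw [e, Real.exp_neg, Real.exp_log (by linarith)]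
    have hDt : D ^ 2 / (d * t) ≤ t := by
      rw [div_le_iff₀ (by positivity)]
      have e : t * (d * t) = D ^ 2 * (2 * Real.log N) := by
        have : t * (d * t) = t ^ 2 * d := by ring
        rw [this, htsq]; field_simp
      rw [e]
      exact le_mul_of_one_le_right (by positivity) (by linarith)
    have hsum : Integrable (fun u => ∑ v ∈ hfin.toFinset, max (⟪v - c, u⟫ - t) 0) (unifBall d) :=
      integrable_finsetSum _ fun v _ => integrable_inner_excess (v - c) t
    have h1 := smoothed_sub_le_of_inner_le hf.continuous hγ hr x c
      (h := fun u => t + ∑ v ∈ hfin.toFinset, max (⟪v - c, u⟫ - t) 0)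
      ((integrable_const _).add hsum) (by
        filter_upwards [hae] with u hu
        exact inner_sub_le_of_mem_convexHull hfin (by rw [hhull]; exact hGK hu) t)
    refine h1.trans ?_
    gcongr
    rw [integral_add (integrable_const _) hsum,
      integral_finsetSum _ fun v _ => integrable_inner_excess (v - c) t, integral_const]
    simp only [probReal_univ, smul_eq_mul, one_mul]
    have h2 : ∑ v ∈ hfin.toFinset, ∫ u, max (⟪v - c, u⟫ - t) 0 ∂unifBall d ≤
        ∑ v ∈ hfin.toFinset, N⁻¹ * t := by
      refine Finset.sum_le_sum fun v hv => ?_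
      have hv' : v ∈ V := hfin.mem_toFinset.1 hv
      have h3 : ‖v - c‖ ≤ D := by
        rw [← dist_eq_norm]
        exact Metric.dist_le_diam_of_mem hK.isCompact.isBounded hv'.1 hcK
      refine (integral_inner_excess_le hd h3 hD ht0).trans ?_
      rw [hexp]
      gcongr
    have h4 : ∑ v ∈ hfin.toFinset, N⁻¹ * t = t := by
      rw [Finset.sum_const, nsmul_eq_mul, ← ncard_eq_toFinset_card V hfin]
      change N * (N⁻¹ * t) = t
      field_simp
    linarith

/-! ### Euclidean projections -/

theorem inner_sub_proj_le {d : ℕ} {X : Set (E d)} (hX : IsClosed X) (hc : Convex ℝ X) (z : E d)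
    {q : E d} (hq : q ∈ X) : ⟪z - proj X z, q - proj X z⟫ ≤ 0 := by
  obtain ⟨hp, hmin⟩ := proj_spec hX ⟨q, hq⟩ z
  refine (norm_eq_iInf_iff_real_inner_le_zero hc hp).1 ?_ q hq
  have : Nonempty X := ⟨⟨q, hq⟩⟩
  refine le_antisymm (le_ciInf fun w => ?_) (ciInf_le (f := fun w : X => ‖z - w‖)
    ⟨0, by rintro _ ⟨w, rfl⟩; exact norm_nonneg _⟩ ⟨proj X z, hp⟩)
  simpa [dist_eq_norm] using hmin w w.2

theorem norm_proj_sub_proj_le {d : ℕ} {X : Set (E d)} (hX : IsClosed X) (hc : Convex ℝ X)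
    (hne : X.Nonempty) (z w : E d) : ‖proj X z - proj X w‖ ≤ ‖z - w‖ := by
  have h1 := inner_sub_proj_le hX hc z (proj_spec hX hne w).1
  have h2 := inner_sub_proj_le hX hc w (proj_spec hX hne z).1
  set p := proj X z
  set q := proj X w
  have h3 : ‖p - q‖ ^ 2 ≤ ⟪z - w, p - q⟫ := by
    have e1 : ⟪z - p, q - p⟫ = -⟪z - p, p - q⟫ := by rw [← inner_neg_right, neg_sub]
    have e2 : ⟪z - w, p - q⟫ = ⟪z - p, p - q⟫ + ⟪p - q, p - q⟫ - ⟪w - q, p - q⟫ := by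
      rw [← inner_add_left, ← inner_sub_left]; congr 1; abel
    rw [real_inner_self_eq_norm_sq] at e2
    linarith
  have h4 := h3.trans (real_inner_le_norm _ _)
  rcases (norm_nonneg (p - q)).eq_or_lt with h0 | h0
  · rw [← h0]; exact norm_nonneg _
  · rw [sq] at h4; exact le_of_mul_le_mul_right h4 h0

theorem continuous_proj {d : ℕ} {X : Set (E d)} (hX : IsClosed X) (hc : Convex ℝ X)
    (hne : X.Nonempty) : Continuous (proj X) := by
  refine (LipschitzWith.of_dist_le_mul (K := 1) fun z w => ?_).continuous
  rw [dist_eq_norm, dist_eq_norm, NNReal.coe_one, one_mul]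
  exact norm_proj_sub_proj_le hX hc hne z w

theorem proj_of_mem {d : ℕ} {X : Set (E d)} (hX : IsClosed X) {x : E d} (hx : x ∈ X) :
    proj X x = x := by
  have := (proj_spec hX ⟨x, hx⟩ x).2 x hx
  rw [dist_self] at this
  exact (dist_le_zero.1 this).symm

/-! ### Deterministic analysis of AGD+ -/

theorem le_add_inner_add_of_lipschitz_gradient {d : ℕ} {F : E d → ℝ} {D : E d → E d} {K : ℝ≥0}
    (hF : ∀ x, HasGradientAt F (D x) x) (hD : LipschitzWith K D) (x y : E d) :
    F y ≤ F x + ⟪D x, y - x⟫ + K / 2 * ‖y - x‖ ^ 2 := by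
  set v := y - x with hv
  -- The claim is `g 1 ≤ g 0`; the Lipschitz bound on `D` makes `g` nonincreasing on `[0, 1]`.
  set g : ℝ → ℝ := fun t => F (x + t • v) - t * ⟪D x, v⟫ - K / 2 * ‖v‖ ^ 2 * t ^ 2 with hg
  have hder : ∀ t, HasDerivAt g (⟪D (x + t • v), v⟫ - ⟪D x, v⟫ - K / 2 * ‖v‖ ^ 2 * (2 * t)) t := by
    intro t
    have h1 : HasDerivAt (fun t : ℝ => x + t • v) v t := by
      simpa using ((hasDerivAt_id t).smul_const v).const_add x
    have h2 : HasDerivAt (fun t : ℝ => F (x + t • v)) (⟪D (x + t • v), v⟫) t := by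
      exact (hF (x + t • v)).hasFDerivAt.comp_hasDerivAt t h1
    have h3 : HasDerivAt (fun t : ℝ => t * ⟪D x, v⟫) (⟪D x, v⟫) t := by
      simpa using (hasDerivAt_id t).mul_const (⟪D x, v⟫)
    have h4 : HasDerivAt (fun t : ℝ => K / 2 * ‖v‖ ^ 2 * t ^ 2) (K / 2 * ‖v‖ ^ 2 * (2 * t)) t := by
      simpa using (hasDerivAt_pow 2 t).const_mul (K / 2 * ‖v‖ ^ 2)
    exact (h2.sub h3).sub h4
  have hanti : AntitoneOn g (Icc 0 1) := by
    refine antitoneOn_of_deriv_nonpos (convex_Icc 0 1)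
      (fun t _ => (hder t).continuousAt.continuousWithinAt)
      (fun t _ => (hder t).differentiableAt.differentiableWithinAt) fun t ht => ?_
    rw [interior_Icc] at ht
    rw [(hder t).deriv]
    have h5 : ⟪D (x + t • v) - D x, v⟫ ≤ K * (t * ‖v‖) * ‖v‖ := by
      refine (real_inner_le_norm _ _).trans ?_
      gcongr
      have := hD.dist_le_mul (x + t • v) x
      rwa [dist_eq_norm, dist_eq_norm, add_sub_cancel_left, norm_smul, Real.norm_eq_abs,
        abs_of_pos ht.1] at this
    rw [inner_sub_left] at h5
    linarith
  have h6 := hanti (left_mem_Icc.2 zero_le_one) (right_mem_Icc.2 zero_le_one) zero_le_one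
  simp only [hg, one_smul, zero_smul, add_zero, one_mul, zero_mul, sub_zero, one_pow, mul_one,
    ne_eq, OfNat.ofNat_ne_zero, not_false_eq_true, zero_pow, mul_zero] at h6
  rw [hv, add_sub_cancel] at h6
  linarith

/-- The dual variable before iteration `k` of AGD+. -/
def agdPrev {d : ℕ} (X : Set (E d)) (a : ℕ → ℝ) (G : ℕ → E d → E d) (x₀ : E d) : ℕ → E d
  | 0 => x₀
  | k + 1 => (agdPlus X a G x₀ k).z

theorem agdPlus_z {d : ℕ} (X : Set (E d)) (a : ℕ → ℝ) (G : ℕ → E d → E d) (x₀ : E d) (k : ℕ) :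
    (agdPlus X a G x₀ k).z = agdPrev X a G x₀ k - a k • G k (agdPlus X a G x₀ k).x := by
  cases k <;> rfl

/-- Smoothness from `x` to `y`, plus convexity from `x` to `y'` with weight `A'`. Since `y - x =
(a/A) (p - p')`, the step-size condition reduces the quadratic term to `‖p - p'‖² / 2`. -/
theorem agd_primal_step {d : ℕ} {F : E d → ℝ} {D : E d → E d} {K : ℝ≥0}
    (hconv : ∀ x y, F x + ⟪D x, y - x⟫ ≤ F y)
    (hF : ∀ x, HasGradientAt F (D x) x) (hD : LipschitzWith K D)
    {A A' a : ℝ} (hA' : 0 ≤ A') (hA : A = A' + a) (ha : 0 < a) (hstep : K * a ^ 2 ≤ A)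
    {x y y' p p' : E d} (hx : x = (A' / A) • y' + (a / A) • p')
    (hy : y = (A' / A) • y' + (a / A) • p) :
    A * F y - A' * F y' ≤ a * F x + a * ⟪D x, p - x⟫ + 1 / 2 * ‖p - p'‖ ^ 2 := by
  have hA0 : 0 < A := by linarith
  have hyx : y - x = (a / A) • (p - p') := by rw [hx, hy, smul_sub]; abel
  have h1 := le_add_inner_add_of_lipschitz_gradient hF hD x y
  have h2 := mul_le_mul_of_nonneg_left (hconv x y') hA'
  have h3 : A • (y - x) = A' • (y' - x) + a • (p - x) := by
    have e : A • y = A' • y' + a • p := by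
      rw [hy, smul_add, smul_smul, smul_smul, mul_div_cancel₀ _ hA0.ne', mul_div_cancel₀ _ hA0.ne']
    rw [smul_sub, e, smul_sub, smul_sub, hA, add_smul]; abel
  have h4 : A * ⟪D x, y - x⟫ = A' * ⟪D x, y' - x⟫ + a * ⟪D x, p - x⟫ := by
    rw [← real_inner_smul_right, h3, inner_add_right, real_inner_smul_right, real_inner_smul_right]
  have h5 : A * (K / 2 * ‖y - x‖ ^ 2) ≤ 1 / 2 * ‖p - p'‖ ^ 2 := by
    rw [hyx, norm_smul, Real.norm_eq_abs, abs_of_pos (by positivity)]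
    have e : A * (K / 2 * (a / A * ‖p - p'‖) ^ 2) = (K * a ^ 2 / A) * (1 / 2 * ‖p - p'‖ ^ 2) := by
      field_simp
    rw [e]
    exact mul_le_of_le_one_left (by positivity) ((div_le_one hA0).2 hstep)
  have h6 := mul_le_mul_of_nonneg_left h1 hA0.le
  have h7 : A * F x = A' * F x + a * F x := by rw [hA]; ring
  linarith

/-- The optimal value of the regularized linear model at the dual point `z`, relative to `xs`. -/
def dualGap {d : ℕ} (X : Set (E d)) (x₀ xs z : E d) : ℝ :=
  1 / 2 * ‖proj X z - x₀‖ ^ 2 + ⟪x₀ - z, proj X z - xs⟫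

/-- The projection of `z` minimizes over `X` the 1-strongly convex function `q ↦ ‖q - x₀‖²/2 + ⟪x₀ -
z, q⟫`. -/
theorem half_norm_sq_add_inner_le {d : ℕ} {X : Set (E d)} (hX : IsClosed X) (hc : Convex ℝ X)
    {q : E d} (hq : q ∈ X) (x₀ z : E d) :
    1 / 2 * ‖proj X z - x₀‖ ^ 2 + ⟪x₀ - z, proj X z⟫ + 1 / 2 * ‖q - proj X z‖ ^ 2 ≤
      1 / 2 * ‖q - x₀‖ ^ 2 + ⟪x₀ - z, q⟫ := by
  have h1 := inner_sub_proj_le hX hc z hq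
  set p := proj X z
  have e1 : ‖q - x₀‖ ^ 2 = ‖q - p‖ ^ 2 + 2 * ⟪q - p, p - x₀⟫ + ‖p - x₀‖ ^ 2 := by
    rw [← norm_add_sq_real]; congr 2; abel
  have e2 : ⟪z - p, q - p⟫ = -⟪q - p, p - x₀⟫ - ⟪x₀ - z, q⟫ + ⟪x₀ - z, p⟫ := by
    have : z - p = -(p - x₀) - (x₀ - z) := by abel
    rw [this, inner_sub_left, inner_neg_left, real_inner_comm (q - p), inner_sub_right (x₀ - z)]
    ring
  linarith

theorem dualGap_le {d : ℕ} {X : Set (E d)} (hX : IsClosed X) (hc : Convex ℝ X)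
    {xs : E d} (hxs : xs ∈ X) (x₀ z : E d) : dualGap X x₀ xs z ≤ 1 / 2 * ‖xs - x₀‖ ^ 2 := by
  have h := half_norm_sq_add_inner_le hX hc hxs x₀ z
  rw [dualGap, inner_sub_right]
  have : 0 ≤ 1 / 2 * ‖xs - proj X z‖ ^ 2 := by positivity
  linarith

/-- Strong convexity supplies exactly the quadratic term that `agd_primal_step` spends. -/
theorem dualGap_step {d : ℕ} {X : Set (E d)} (hX : IsClosed X) (hc : Convex ℝ X)
    (hne : X.Nonempty) (x₀ xs z' g : E d) (a : ℝ) :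
    dualGap X x₀ xs z' + a * ⟪g, proj X (z' - a • g) - xs⟫ +
      1 / 2 * ‖proj X (z' - a • g) - proj X z'‖ ^ 2 ≤ dualGap X x₀ xs (z' - a • g) := by
  have h := half_norm_sq_add_inner_le hX hc (proj_spec hX hne (z' - a • g)).1 x₀ z'
  set p := proj X (z' - a • g)
  have e : x₀ - (z' - a • g) = (x₀ - z') + a • g := by abel
  simp only [dualGap]
  rw [e, inner_add_left, real_inner_smul_left, inner_sub_right (x₀ - z'), inner_sub_right (x₀ - z')]
  linarith

/-- The error of one iteration of AGD+ with gradient `D` and gradient estimate `g`. -/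
def agdError {d : ℕ} (X : Set (E d)) (D : E d → E d) (xs : E d) (a : ℝ) (g x z : E d) : ℝ :=
  a * ⟪D x - g, proj X (z - a • D x) - xs⟫ + a ^ 2 * ‖D x - g‖ ^ 2

/-- Moves the dependence on `g` out of the projected point: by nonexpansiveness the points for `g`
and for `D x` differ by at most `a ‖D x - g‖`. -/
theorem mul_inner_le_agdError {d : ℕ} {X : Set (E d)} (hX : IsClosed X) (hc : Convex ℝ X)
    (hne : X.Nonempty) (D : E d → E d) {a : ℝ} (ha : 0 ≤ a) (xs g x z : E d) :
    a * ⟪D x - g, proj X (z - a • g) - xs⟫ ≤ agdError X D xs a g x z := by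
  have h1 := norm_proj_sub_proj_le hX hc hne (z - a • g) (z - a • D x)
  have e1 : z - a • g - (z - a • D x) = a • (D x - g) := by rw [smul_sub]; abel
  rw [e1, norm_smul, Real.norm_eq_abs, abs_of_nonneg ha] at h1
  have h2 : ⟪D x - g, proj X (z - a • g) - proj X (z - a • D x)⟫ ≤ a * ‖D x - g‖ ^ 2 := by
    refine (real_inner_le_norm _ _).trans ?_
    calc ‖D x - g‖ * ‖proj X (z - a • g) - proj X (z - a • D x)‖
        ≤ ‖D x - g‖ * (a * ‖D x - g‖) := by gcongr
      _ = _ := by ring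
  have e2 : proj X (z - a • g) - xs =
      (proj X (z - a • g) - proj X (z - a • D x)) + (proj X (z - a • D x) - xs) := by abel
  rw [agdError, e2, inner_add_right, mul_add]
  have h3 := mul_le_mul_of_nonneg_left h2 ha
  linarith

theorem stepSum_succ (a : ℕ → ℝ) (k : ℕ) : stepSum a (k + 1) = stepSum a k + a (k + 1) :=
  Finset.sum_range_succ _ _

theorem stepSum_pos {a : ℕ → ℝ} (ha : ∀ k, 0 < a k) (k : ℕ) : 0 < stepSum a k :=
  Finset.sum_pos (fun i _ => ha i) ⟨0, by simp⟩

theorem agdPlus_gap_le {d : ℕ} {X : Set (E d)} (hX : IsClosed X) (hc : Convex ℝ X)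
    {F : E d → ℝ} {D : E d → E d} {K : ℝ≥0}
    (hconv : ∀ x y, F x + ⟪D x, y - x⟫ ≤ F y)
    (hF : ∀ x, HasGradientAt F (D x) x) (hD : LipschitzWith K D)
    {a : ℕ → ℝ} (ha : IsStepSize a K) (G : ℕ → E d → E d) {x₀ xs : E d} (hx₀ : x₀ ∈ X)
    (hxs : xs ∈ X) (k : ℕ) :
    stepSum a k * (F (agdPlus X a G x₀ k).y - F xs) ≤ 1 / 2 * ‖xs - x₀‖ ^ 2 +
      ∑ i ∈ Finset.range (k + 1), agdError X D xs (a i) (G i (agdPlus X a G x₀ i).x)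
        (agdPlus X a G x₀ i).x (agdPrev X a G x₀ i) := by
  have hne : X.Nonempty := ⟨x₀, hx₀⟩
  suffices h : stepSum a k * (F (agdPlus X a G x₀ k).y - F xs) ≤
      dualGap X x₀ xs (agdPlus X a G x₀ k).z +
      ∑ i ∈ Finset.range (k + 1), agdError X D xs (a i) (G i (agdPlus X a G x₀ i).x)
        (agdPlus X a G x₀ i).x (agdPrev X a G x₀ i) by
    linarith [dualGap_le hX hc hxs x₀ (agdPlus X a G x₀ k).z]
  -- The potential `A_k (F y_k - F xs) - dualGap z_k` grows by at most the error of the iteration.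
  have hstep : ∀ (A A' b : ℝ) (x y y' z' g : E d), 0 ≤ A' → A = A' + b → 0 < b → K * b ^ 2 ≤ A →
      x = (A' / A) • y' + (b / A) • proj X z' →
      y = (A' / A) • y' + (b / A) • proj X (z' - b • g) →
      A * (F y - F xs) ≤ A' * (F y' - F xs) - dualGap X x₀ xs z' +
        dualGap X x₀ xs (z' - b • g) + agdError X D xs b g x z' := by
    intro A A' b x y y' z' g hA' hA hb hK hx hy
    have h1 := agd_primal_step hconv hF hD hA' hA hb hK hx hy
    have h2 := dualGap_step hX hc hne x₀ xs z' g b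
    have h3 := mul_inner_le_agdError hX hc hne D hb.le xs g x z'
    have h4 := mul_le_mul_of_nonneg_left (hconv x xs) hb.le
    set p := proj X (z' - b • g)
    have e1 : ⟪D x, p - x⟫ = ⟪D x, p - xs⟫ + ⟪D x, xs - x⟫ := by
      rw [← inner_add_right]; congr 1; abel
    have e2 : ⟪D x - g, p - xs⟫ = ⟪D x, p - xs⟫ - ⟪g, p - xs⟫ := inner_sub_left ..
    have e3 : A * F xs = A' * F xs + b * F xs := by rw [hA]; ring
    rw [e2] at h3
    rw [e1] at h1
    linarith
  induction k with
  | zero =>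
    have hs : stepSum a 0 = a 0 := by simp [stepSum]
    have h0 : dualGap X x₀ xs x₀ = 0 := by simp [dualGap, proj_of_mem hX hx₀]
    -- The first iteration is a general one with `A' = 0` and previous points `x₀`, as `x₀` is its
    -- own projection.
    have := hstep (stepSum a 0) 0 (a 0) x₀ (proj X (x₀ - a 0 • G 0 x₀)) x₀ x₀ (G 0 x₀) le_rfl
      (by rw [hs, zero_add]) (ha.1 0) (ha.2 0)
      (by rw [hs, div_self (ha.1 0).ne', proj_of_mem hX hx₀]; simp)
      (by rw [hs, div_self (ha.1 0).ne']; simp)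
    rw [h0, zero_mul, sub_zero, zero_add] at this
    rw [zero_add, Finset.sum_range_one]
    exact this
  | succ k ih =>
    have := hstep (stepSum a (k + 1)) (stepSum a k) (a (k + 1)) (agdPlus X a G x₀ (k + 1)).x
      (agdPlus X a G x₀ (k + 1)).y (agdPlus X a G x₀ k).y (agdPlus X a G x₀ k).z
      (G (k + 1) (agdPlus X a G x₀ (k + 1)).x) (stepSum_pos ha.1 k).le (stepSum_succ a k)
      (ha.1 _) (ha.2 _) rfl rfl
    rw [Finset.sum_range_succ]
    have hz : (agdPlus X a G x₀ (k + 1)).z = (agdPlus X a G x₀ k).z -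
      a (k + 1) • G (k + 1) (agdPlus X a G x₀ (k + 1)).x := rfl
    rw [hz]
    have hp : agdPrev X a G x₀ (k + 1) = (agdPlus X a G x₀ k).z := rfl
    rw [hp]
    linarith

/-! ### AGD+ with the randomized subgradient oracle -/

/-- The gradient oracle `γ (x + r u_i)`. -/
def ballOracle {d : ℕ} (γ : E d → E d) (r : ℝ) (u : ℕ → E d) (i : ℕ) (x : E d) : E d :=
  γ (x + r • u i)

theorem measurable_agdPlus {d : ℕ} {X : Set (E d)} (hX : Measurable (proj X)) (a : ℕ → ℝ)
    {γ : E d → E d} (hγ : Measurable γ) (r : ℝ) (x₀ : E d) (k : ℕ) :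
    Measurable (fun u => (agdPlus X a (ballOracle γ r u) x₀ k).x) ∧
    Measurable (fun u => (agdPlus X a (ballOracle γ r u) x₀ k).z) ∧
    Measurable (fun u => (agdPlus X a (ballOracle γ r u) x₀ k).y) := by
  induction k with
  | zero =>
    have hz : Measurable fun u : ℕ → E d => x₀ - a 0 • γ (x₀ + r • u 0) := by fun_prop
    exact ⟨measurable_const, hz, hX.comp hz⟩
  | succ k ih =>
    obtain ⟨_, hz, hy⟩ := ih
    have hcomb : ∀ (α β : ℝ) {y z : (ℕ → E d) → E d}, Measurable y → Measurable z →
        Measurable fun u => α • y u + β • proj X (z u) := fun α β y z hy hz =>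
      (hy.const_smul α).add ((hX.comp hz).const_smul β)
    have hx' : Measurable (fun u => (agdPlus X a (ballOracle γ r u) x₀ (k + 1)).x) :=
      hcomb _ _ hy hz
    have hz' : Measurable (fun u => (agdPlus X a (ballOracle γ r u) x₀ k).z -
        a (k + 1) • γ ((agdPlus X a (ballOracle γ r u) x₀ (k + 1)).x + r • u (k + 1))) := by
      fun_prop
    exact ⟨hx', hz', hcomb _ _ hy hz'⟩

theorem measurable_agdPrev {d : ℕ} {X : Set (E d)} (hX : Measurable (proj X)) (a : ℕ → ℝ)
    {γ : E d → E d} (hγ : Measurable γ) (r : ℝ) (x₀ : E d) (k : ℕ) :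
    Measurable (fun u => agdPrev X a (ballOracle γ r u) x₀ k) := by
  cases k with
  | zero => exact measurable_const
  | succ k => exact (measurable_agdPlus hX a hγ r x₀ k).2.1

theorem agdPlus_congr {d : ℕ} {X : Set (E d)} (a : ℕ → ℝ) (γ : E d → E d) (r : ℝ) (x₀ : E d)
    {u v : ℕ → E d} (k : ℕ) (h : ∀ i ≤ k, u i = v i) :
    agdPlus X a (ballOracle γ r u) x₀ k = agdPlus X a (ballOracle γ r v) x₀ k := by
  induction k with
  | zero => simp only [agdPlus, ballOracle, h 0 le_rfl]
  | succ k ih =>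
    simp only [agdPlus, ballOracle, h (k + 1) le_rfl]
    have := ih fun i hi => h i (by omega)
    rw [this]

/-- The strict bound `i < k` is what makes the query point and the previous dual point independent
of the sample `u k`. -/
theorem agdPlus_x_congr {d : ℕ} {X : Set (E d)} (a : ℕ → ℝ) (γ : E d → E d) (r : ℝ) (x₀ : E d)
    {u v : ℕ → E d} (k : ℕ) (h : ∀ i < k, u i = v i) :
    (agdPlus X a (ballOracle γ r u) x₀ k).x = (agdPlus X a (ballOracle γ r v) x₀ k).x ∧
    agdPrev X a (ballOracle γ r u) x₀ k = agdPrev X a (ballOracle γ r v) x₀ k := by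
  cases k with
  | zero => exact ⟨rfl, rfl⟩
  | succ k =>
    have := agdPlus_congr (X := X) a γ r x₀ k fun i hi => h i (by omega)
    simp only [agdPlus, agdPrev, this, and_self]

theorem norm_proj_le {d : ℕ} {X : Set (E d)} (hX : IsClosed X) (hc : Convex ℝ X)
    (hne : X.Nonempty) (z : E d) : ‖proj X z‖ ≤ ‖z‖ + ‖proj X 0‖ := by
  have := norm_proj_sub_proj_le hX hc hne z 0
  rw [sub_zero] at this
  linarith [norm_le_norm_sub_add (proj X z) (proj X 0)]

theorem agdPlus_z_bounded {d : ℕ} {X : Set (E d)} (a : ℕ → ℝ) {γ : E d → E d}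
    (hb : ∀ R, ∃ M, ∀ x : E d, ‖x‖ ≤ R → ‖γ x‖ ≤ M) {r : ℝ} (hr : 0 < r) (x₀ : E d) (k : ℕ)
    (R : ℝ) : ∃ R', ∀ u : ℕ → E d, (∀ i, ‖u i‖ ≤ 1) →
      ‖(agdPlus X a (ballOracle γ r u) x₀ k).x‖ ≤ R → ‖agdPrev X a (ballOracle γ r u) x₀ k‖ ≤ R →
      ‖(agdPlus X a (ballOracle γ r u) x₀ k).z‖ ≤ R' := by
  obtain ⟨M, hM⟩ := hb (R + r)
  refine ⟨R + |a k| * M, fun u hu hx hz => ?_⟩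
  rw [agdPlus_z]
  refine (norm_sub_le _ _).trans ?_
  rw [norm_smul, Real.norm_eq_abs]
  gcongr
  exact hM _ ((norm_add_smul_le hr (hu k)).trans (by gcongr))

theorem agdPlus_bounded {d : ℕ} {X : Set (E d)} (hX : IsClosed X) (hc : Convex ℝ X)
    (a : ℕ → ℝ) {γ : E d → E d} (hb : ∀ R, ∃ M, ∀ x : E d, ‖x‖ ≤ R → ‖γ x‖ ≤ M) {r : ℝ}
    (hr : 0 < r) {x₀ : E d} (hx₀ : x₀ ∈ X) (k : ℕ) :
    ∃ R, ∀ u : ℕ → E d, (∀ i, ‖u i‖ ≤ 1) →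
      ‖(agdPlus X a (ballOracle γ r u) x₀ k).x‖ ≤ R ∧
      ‖agdPrev X a (ballOracle γ r u) x₀ k‖ ≤ R ∧
      ‖(agdPlus X a (ballOracle γ r u) x₀ k).y‖ ≤ R := by
  have hne : X.Nonempty := ⟨x₀, hx₀⟩
  have hstep := fun k => agdPlus_z_bounded (X := X) a hb hr x₀ k
  induction k with
  | zero =>
    obtain ⟨R', hR'⟩ := hstep 0 ‖x₀‖
    refine ⟨max ‖x₀‖ (R' + ‖proj X 0‖), fun u hu => ⟨le_max_left _ _, le_max_left _ _, ?_⟩⟩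
    exact (norm_proj_le hX hc hne _).trans
      (le_trans (by gcongr; exact hR' u hu le_rfl le_rfl) (le_max_right _ _))
  | succ k ih =>
    obtain ⟨R, hR⟩ := ih
    obtain ⟨R₁, hR₁⟩ := hstep k R
    set α := stepSum a k / stepSum a (k + 1)
    set β := a (k + 1) / stepSum a (k + 1)
    have hcomb : ∀ y z : E d, ‖α • y + β • proj X z‖ ≤
        |α| * ‖y‖ + |β| * (‖z‖ + ‖proj X 0‖) := fun y z => by
      refine (norm_add_le _ _).trans ?_
      rw [norm_smul, norm_smul, Real.norm_eq_abs, Real.norm_eq_abs]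
      gcongr
      exact norm_proj_le hX hc hne z
    obtain ⟨R₂, hR₂⟩ := hstep (k + 1) (max R₁ (|α| * R + |β| * (R₁ + ‖proj X 0‖)))
    refine ⟨max (max R₁ (|α| * R + |β| * (R₁ + ‖proj X 0‖)))
      (|α| * R + |β| * (R₂ + ‖proj X 0‖)), fun u hu => ?_⟩
    obtain ⟨hx, hp, hy⟩ := hR u hu
    have hz := hR₁ u hu hx hp
    have hx' : ‖(agdPlus X a (ballOracle γ r u) x₀ (k + 1)).x‖ ≤
        max R₁ (|α| * R + |β| * (R₁ + ‖proj X 0‖)) :=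
      (hcomb _ _).trans (le_trans (by gcongr) (le_max_right _ _))
    have hz' := hR₂ u hu hx' (hz.trans (le_max_left _ _))
    exact ⟨hx'.trans (le_max_left _ _), (hz.trans (le_max_left _ _)).trans (le_max_left _ _),
      (hcomb _ _).trans (le_trans (by gcongr; exact hz') (le_max_right _ _))⟩

/-! ### Variance of the oracle and expected error of an iteration. -/

theorem IsBVGMax.norm_meanSubgradient_sub_le {d : ℕ} {f : E d → ℝ} {γ : E d → E d} {r Lhat : ℝ}
    (hm : IsBVGMax f γ r Lhat) (hr : 0 < r) (hγ : Measurable γ) (x : E d) {u : E d}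
    (hu : ‖u‖ ≤ 1) : ‖meanSubgradient γ r x - γ (x + r • u)‖ ≤ 2 * Lhat := by
  have h1 := hm.norm_sub_meanSubgradient_le hr hγ x (γ x)
    (fun u hu => hm.2.2 x u (mem_closedBall_zero_iff.2 hu))
  have h2 := hm.2.2 x u (mem_closedBall_zero_iff.2 hu)
  rw [norm_sub_rev] at h2
  calc _ ≤ ‖meanSubgradient γ r x - γ x‖ + ‖γ x - γ (x + r • u)‖ :=
        norm_sub_le_norm_sub_add_norm_sub ..
    _ ≤ 2 * Lhat := by linarith

/-- With noise `n = c - γ (x + r u)`, split one factor of `‖n‖²` as `n = (γ x - γ (x + r u)) + (c -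
γ x)`. The second part is constant and pairs with `n` to mean zero; the first has norm at most `L̂`,
which leaves `L̂` times the mean of `‖n‖`. -/
theorem IsBVGAvg.integral_norm_sq_le {d : ℕ} (hd : 0 < d) {f : E d → ℝ} {γ : E d → E d}
    {r L Lhat : ℝ} (h : IsBVGAvg f γ r L) (hm : IsBVGMax f γ r Lhat) (hr : 0 < r)
    (hγ : IsSubgradientSelection f γ) (x : E d) :
    ∫ u, ‖meanSubgradient γ r x - γ (x + r • u)‖ ^ 2 ∂unifBall d ≤ Lhat * L := by
  have hγm := hγ.1
  have hL := hm.2.1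
  set c := meanSubgradient γ r x with hc
  have hi := hm.integrable hr hγ.1 hr x
  have hi1 : Integrable (fun u => c - γ (x + r • u)) (unifBall d) := (integrable_const _).sub hi
  have hi2 : Integrable (fun u => ⟪c - γ x, c - γ (x + r • u)⟫) (unifBall d) := hi1.const_inner _
  have hz : ∫ u, ⟪c - γ x, c - γ (x + r • u)⟫ ∂unifBall d = 0 := by
    rw [integral_inner hi1, integral_sub (integrable_const _) hi, integral_const]
    simp [hc, meanSubgradient]
  have hi3 : Integrable (fun u => Lhat * ‖c - γ (x + r • u)‖ + ⟪c - γ x, c - γ (x + r • u)⟫)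
      (unifBall d) := (hi1.norm.const_mul _).add hi2
  calc ∫ u, ‖c - γ (x + r • u)‖ ^ 2 ∂unifBall d
      ≤ ∫ u, (Lhat * ‖c - γ (x + r • u)‖ + ⟪c - γ x, c - γ (x + r • u)⟫) ∂unifBall d := by
        refine integral_mono_ae ?_ hi3 (ae_unifBall fun u hu => ?_)
        · refine integrable_unifBall (Measurable.aestronglyMeasurable (by fun_prop))
            ((2 * Lhat) ^ 2) fun u hu => ?_
          rw [norm_pow, norm_norm]
          gcongr
          exact hm.norm_meanSubgradient_sub_le hr hγ.1 x hu
        · have h1 : ‖γ x - γ (x + r • u)‖ ≤ Lhat := by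
            rw [norm_sub_rev]; exact hm.2.2 x u (mem_closedBall_zero_iff.2 hu)
          have h2 : ⟪γ x - γ (x + r • u), c - γ (x + r • u)⟫ ≤ Lhat * ‖c - γ (x + r • u)‖ :=
            (real_inner_le_norm _ _).trans (by gcongr)
          have h3 : ‖c - γ (x + r • u)‖ ^ 2 = ⟪γ x - γ (x + r • u), c - γ (x + r • u)⟫ +
              ⟪c - γ x, c - γ (x + r • u)⟫ := by
            rw [← inner_add_left, ← real_inner_self_eq_norm_sq]; congr 1; abel
          change ‖c - γ (x + r • u)‖ ^ 2 ≤ _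
          linarith
    _ = Lhat * ∫ u, ‖γ (x + r • u) - c‖ ∂unifBall d := by
        rw [integral_add (hi1.norm.const_mul _) hi2, hz, add_zero, integral_const_mul]
        simp only [norm_sub_rev c]
    _ ≤ Lhat * L := by gcongr; exact h.integral_norm_le hd hm hr hγ x

theorem IsBVGAvg.integral_agdError_le {d : ℕ} (hd : 0 < d) {f : E d → ℝ} {γ : E d → E d}
    {r L Lhat : ℝ} (h : IsBVGAvg f γ r L) (hm : IsBVGMax f γ r Lhat) (hr : 0 < r)
    (hγ : IsSubgradientSelection f γ) (X : Set (E d)) (xs : E d) (a : ℝ) (x z : E d) :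
    ∫ u, agdError X (meanSubgradient γ r) xs a (γ (x + r • u)) x z ∂unifBall d ≤
      a ^ 2 * (Lhat * L) := by
  have hγm := hγ.1
  set c := meanSubgradient γ r x with hc
  have hi := hm.integrable hr hγ.1 hr x
  have hi1 : Integrable (fun u => c - γ (x + r • u)) (unifBall d) := (integrable_const _).sub hi
  set q := proj X (z - a • c) - xs with hq
  have hi2 : Integrable (fun u => ⟪q, c - γ (x + r • u)⟫) (unifBall d) := hi1.const_inner _
  have hz : ∫ u, ⟪q, c - γ (x + r • u)⟫ ∂unifBall d = 0 := by
    rw [integral_inner hi1, integral_sub (integrable_const _) hi, integral_const]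
    simp [hc, meanSubgradient]
  have hi3 : Integrable (fun u => ‖c - γ (x + r • u)‖ ^ 2) (unifBall d) := by
    refine integrable_unifBall (Measurable.aestronglyMeasurable (by fun_prop))
      ((2 * Lhat) ^ 2) fun u hu => ?_
    rw [norm_pow, norm_norm]
    gcongr
    exact hm.norm_meanSubgradient_sub_le hr hγ.1 x hu
  have e : ∀ u, agdError X (meanSubgradient γ r) xs a (γ (x + r • u)) x z =
      a * ⟪q, c - γ (x + r • u)⟫ + a ^ 2 * ‖c - γ (x + r • u)‖ ^ 2 := fun u => by
    rw [agdError, real_inner_comm]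
  simp only [e]
  rw [integral_add (hi2.const_mul _) (hi3.const_mul _), integral_const_mul, integral_const_mul, hz,
    mul_zero, zero_add]
  gcongr
  exact h.integral_norm_sq_le hd hm hr hγ x

/-- Fubini for the product law; it plays the role of conditioning on the past. -/
theorem integral_comp_indep_le {Ω S T : Type*} [MeasurableSpace Ω] [MeasurableSpace S]
    [MeasurableSpace T] {P : Measure Ω} [IsProbabilityMeasure P] {s : Ω → S} {t : Ω → T}
    (hs : Measurable s) (ht : Measurable t) (hind : IndepFun s t P) {h : S × T → ℝ}
    (hh : Measurable h) (hi : Integrable (fun ω => h (s ω, t ω)) P) {C : ℝ}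
    (hC : ∀ x, ∫ y, h (x, y) ∂(P.map t) ≤ C) : ∫ ω, h (s ω, t ω) ∂P ≤ C := by
  have hst : Measurable fun ω => (s ω, t ω) := hs.prodMk ht
  have hmap := (indepFun_iff_map_prod_eq_prod_map_map hs.aemeasurable ht.aemeasurable).1 hind
  have := Measure.isProbabilityMeasure_map (μ := P) hs.aemeasurable
  have := Measure.isProbabilityMeasure_map (μ := P) ht.aemeasurable
  have hi' : Integrable h ((P.map s).prod (P.map t)) := by
    rw [← hmap, integrable_map_measure hh.aestronglyMeasurable hst.aemeasurable]; exact hi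
  rw [← integral_map (f := h) hst.aemeasurable hh.aestronglyMeasurable, hmap, integral_prod _ hi']
  calc ∫ x, ∫ y, h (x, y) ∂(P.map t) ∂(P.map s) ≤ ∫ _, C ∂(P.map s) :=
        integral_mono hi'.integral_prod_left (integrable_const _) hC
    _ = C := by simp

theorem IsUnifBallSample.map_eq {d : ℕ} {Ω : Type*} [MeasurableSpace Ω] {P : Measure Ω}
    {u : ℕ → Ω → E d} (h : IsUnifBallSample P u) (k : ℕ) : P.map (u k) = unifBall d := h.2.2 k

theorem IsUnifBallSample.ae_norm_le {d : ℕ} {Ω : Type*} [MeasurableSpace Ω] {P : Measure Ω}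
    {u : ℕ → Ω → E d} (h : IsUnifBallSample P u) : ∀ᵐ ω ∂P, ∀ i, ‖u i ω‖ ≤ 1 := by
  refine ae_all_iff.2 fun i => ?_
  have : ∀ᵐ v ∂P.map (u i), ‖v‖ ≤ 1 := by
    rw [h.map_eq]; exact ae_unifBall fun _ h => h
  exact ae_of_ae_map (h.1 i).aemeasurable this

theorem IsUnifBallSample.indepFun_state {d : ℕ} {Ω : Type*} [MeasurableSpace Ω] {P : Measure Ω}
    {u : ℕ → Ω → E d} (h : IsUnifBallSample P u) {X : Set (E d)} (hX : Measurable (proj X))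
    (a : ℕ → ℝ) {γ : E d → E d} (hγ : Measurable γ) (r : ℝ) (x₀ : E d) (k : ℕ) :
    IndepFun (fun ω => ((agdPlus X a (ballOracle γ r (fun i => u i ω)) x₀ k).x,
      agdPrev X a (ballOracle γ r (fun i => u i ω)) x₀ k)) (u k) P := by
  have hind := h.2.1.indepFun_finset (Finset.range k) {k} (by simp) h.1
  -- Padding the first `k` samples by zeros leaves the state before iteration `k` unchanged and
  -- exhibits it as a measurable function of these samples alone.
  set ext : (Finset.range k → E d) → ℕ → E d :=
    fun v i => if hi : i ∈ Finset.range k then v ⟨i, hi⟩ else 0 with hext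
  have hextm : Measurable ext := by
    refine measurable_pi_lambda _ fun i => ?_
    by_cases hi : i ∈ Finset.range k
    · simp only [hext, hi, dite_true]; exact measurable_pi_apply _
    · simp only [hext, hi, dite_false]; exact measurable_const
  have hφ : Measurable fun v => ((agdPlus X a (ballOracle γ r (ext v)) x₀ k).x,
      agdPrev X a (ballOracle γ r (ext v)) x₀ k) :=
    ((measurable_agdPlus hX a hγ r x₀ k).1.comp hextm).prodMk
      ((measurable_agdPrev hX a hγ r x₀ k).comp hextm)
  have hψ : Measurable fun v : ({k} : Finset ℕ) → E d => v ⟨k, Finset.mem_singleton_self k⟩ :=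
    measurable_pi_apply _
  have hstate : (fun ω => ((agdPlus X a (ballOracle γ r (fun i => u i ω)) x₀ k).x,
      agdPrev X a (ballOracle γ r (fun i => u i ω)) x₀ k)) =
      (fun v => ((agdPlus X a (ballOracle γ r (ext v)) x₀ k).x,
        agdPrev X a (ballOracle γ r (ext v)) x₀ k)) ∘ fun ω (i : Finset.range k) => u i ω := by
    funext ω
    have := agdPlus_x_congr (X := X) a γ r x₀ (u := fun i => u i ω)
      (v := ext fun i : Finset.range k => u i ω) k fun i hi => by simp [hext, hi]
    exact Prod.ext this.1 this.2
  rw [hstate]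
  exact hind.comp hφ hψ

theorem smoothedAGD_eq {d : ℕ} (X : Set (E d)) (a : ℕ → ℝ) (γ : E d → E d) (r : ℝ) (x₀ : E d)
    (u : ℕ → E d) (k : ℕ) :
    smoothedAGD X a γ r x₀ u k = (agdPlus X a (ballOracle γ r u) x₀ k).y := rfl

theorem smoothedAGD_convergence {d : ℕ} (hd : 0 < d) {X : Set (E d)} {f : E d → ℝ}
    {γ : E d → E d} {xs x₀ : E d} {ε r L Lhat : ℝ} (hX : IsClosed X) (hc : Convex ℝ X)
    (hγ : IsSubgradientSelection f γ) (hxs : xs ∈ X) (hx₀ : x₀ ∈ X)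
    (hr : r ∈ admissibleRadii f xs ε) (hm : IsBVGMax f γ r Lhat) (hav : IsBVGAvg f γ r L)
    {Ω : Type*} [MeasurableSpace Ω] {P : Measure Ω} [IsProbabilityMeasure P]
    {u : ℕ → Ω → E d} (hu : IsUnifBallSample P u) {a : ℕ → ℝ}
    (ha : IsStepSize a (smoothness f r)) (k : ℕ) :
    Integrable (fun ω => f (smoothedAGD X a γ r x₀ (fun i => u i ω) k)) P ∧
    ∫ ω, (f (smoothedAGD X a γ r x₀ (fun i => u i ω) k) - f xs) ∂P ≤
      ε / 2 + (1 / 2 * ‖xs - x₀‖ ^ 2 +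
        ∑ i ∈ Finset.range (k + 1), a i ^ 2 * (Lhat * L)) / stepSum a k := by
  have hr0 := hr.1
  have hne : X.Nonempty := ⟨x₀, hx₀⟩
  have hL := hm.2.1
  have hf := hm.1.continuous
  have hb := hm.norm_le hr0
  have hγm := hγ.1
  have hproj := continuous_proj hX hc hne
  have hpm : Measurable (proj X) := hproj.measurable
  have hlip := hm.lipschitzWith_gradient hd hr0 hγ
  have hDm : Measurable (meanSubgradient γ r) := hlip.continuous.measurable
  have hum : Measurable fun ω => fun i => u i ω := measurable_pi_lambda _ hu.1
  have hae := hu.ae_norm_le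
  have hint : Integrable (fun ω => f (smoothedAGD X a γ r x₀ (fun i => u i ω) k)) P := by
    obtain ⟨R, hR⟩ := agdPlus_bounded hX hc a hb hr0 hx₀ k
    obtain ⟨C, hC⟩ := (isCompact_closedBall (0 : E d) R).exists_bound_of_continuousOn
      hf.continuousOn
    refine Integrable.of_bound (C := C) (hf.measurable.comp
      ((measurable_agdPlus hpm a hγm r x₀ k).2.2.comp hum)).aestronglyMeasurable ?_
    filter_upwards [hae] with ω hω
    exact hC _ (mem_closedBall_zero_iff.2 (hR _ hω).2.2)
  refine ⟨hint, ?_⟩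
  set err : ℕ → Ω → ℝ := fun i ω => agdError X (meanSubgradient γ r) xs (a i)
    (γ ((agdPlus X a (ballOracle γ r (fun i => u i ω)) x₀ i).x + r • u i ω))
    (agdPlus X a (ballOracle γ r (fun i => u i ω)) x₀ i).x
    (agdPrev X a (ballOracle γ r (fun i => u i ω)) x₀ i) with herr
  have herr_int : ∀ i, Integrable (err i) P ∧ ∫ ω, err i ω ∂P ≤ a i ^ 2 * (Lhat * L) := by
    intro i
    set s : Ω → E d × E d := fun ω => ((agdPlus X a (ballOracle γ r (fun i => u i ω)) x₀ i).x,
      agdPrev X a (ballOracle γ r (fun i => u i ω)) x₀ i) with hs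
    set H : (E d × E d) × E d → ℝ := fun p => agdError X (meanSubgradient γ r) xs (a i)
      (γ (p.1.1 + r • p.2)) p.1.1 p.1.2 with hH
    have hHm : Measurable H := by
      simp only [hH, agdError]
      fun_prop
    have hsm : Measurable s := ((measurable_agdPlus hpm a hγm r x₀ i).1.comp hum).prodMk
      ((measurable_agdPrev hpm a hγm r x₀ i).comp hum)
    have hei : Integrable (err i) P := by
      obtain ⟨R, hR⟩ := agdPlus_bounded hX hc a hb hr0 hx₀ i
      obtain ⟨C, hC⟩ := (isCompact_closedBall (0 : E d) R).exists_bound_of_continuousOn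
        hlip.continuous.continuousOn
      refine Integrable.of_bound (C := |a i| * (2 * Lhat * ((R + |a i| * C) + ‖proj X 0‖ + ‖xs‖)) +
        a i ^ 2 * (2 * Lhat) ^ 2) (hHm.comp (hsm.prodMk (hu.1 i))).aestronglyMeasurable ?_
      filter_upwards [hae] with ω hω
      obtain ⟨hx, hz, -⟩ := hR _ hω
      set x := (agdPlus X a (ballOracle γ r (fun i => u i ω)) x₀ i).x
      set z := agdPrev X a (ballOracle γ r (fun i => u i ω)) x₀ i
      have h1 := hm.norm_meanSubgradient_sub_le hr0 hγm x (hω i)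
      have h2 : ‖proj X (z - a i • meanSubgradient γ r x) - xs‖ ≤
          (R + |a i| * C) + ‖proj X 0‖ + ‖xs‖ := by
        refine (norm_sub_le _ _).trans ?_
        gcongr
        refine (norm_proj_le hX hc hne _).trans ?_
        gcongr
        refine (norm_sub_le _ _).trans ?_
        rw [norm_smul, Real.norm_eq_abs]
        gcongr
        exact hC _ (mem_closedBall_zero_iff.2 hx)
      simp only [herr, agdError]
      refine (norm_add_le _ _).trans ?_
      rw [norm_mul, norm_mul, norm_pow, norm_pow, norm_norm, Real.norm_eq_abs, Real.norm_eq_abs,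
        sq_abs]
      gcongr
      exact (abs_real_inner_le_norm _ _).trans (by gcongr)
    refine ⟨hei, ?_⟩
    refine integral_comp_indep_le hsm (hu.1 i) (hu.indepFun_state hpm a hγm r x₀ i) hHm hei
      fun p => ?_
    rw [hu.map_eq]
    exact hav.integral_agdError_le hd hm hr0 hγ X xs (a i) p.1 p.2
  have hA := stepSum_pos ha.1 k
  have hpt : ∀ ω, f (smoothedAGD X a γ r x₀ (fun i => u i ω) k) - f xs ≤
      ε / 2 + (1 / 2 * ‖xs - x₀‖ ^ 2 + ∑ i ∈ Finset.range (k + 1), err i ω) / stepSum a k := by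
    intro ω
    have h1 := agdPlus_gap_le hX hc (smoothed_subgradient hm hr0 hγ)
      (hm.hasGradientAt_smoothed hd hr0 hγ) hlip ha (ballOracle γ r (fun i => u i ω)) hx₀ hxs k
    have h2 := le_smoothed hf hγ hr0 (smoothedAGD X a γ r x₀ (fun i => u i ω) k)
    have h3 := hr.2
    rw [← le_div_iff₀' hA, ← smoothedAGD_eq] at h1
    have h4 : (1 / 2 * ‖xs - x₀‖ ^ 2 + ∑ i ∈ Finset.range (k + 1), err i ω) / stepSum a k ≥
      smoothed f r (smoothedAGD X a γ r x₀ (fun i => u i ω) k) - smoothed f r xs := h1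
    linarith
  have hsumi : Integrable (fun ω => ∑ i ∈ Finset.range (k + 1), err i ω) P :=
    integrable_finsetSum _ fun i _ => (herr_int i).1
  have hsi : Integrable (fun ω => 1 / 2 * ‖xs - x₀‖ ^ 2 + ∑ i ∈ Finset.range (k + 1), err i ω) P :=
    (integrable_const _).add hsumi
  have hdi : Integrable (fun ω => (1 / 2 * ‖xs - x₀‖ ^ 2 +
      ∑ i ∈ Finset.range (k + 1), err i ω) / stepSum a k) P := hsi.div_const _
  refine (integral_mono (hint.sub (integrable_const _)) ((integrable_const _).add hdi) hpt).trans ?_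
  change ∫ ω, (ε / 2 + (1 / 2 * ‖xs - x₀‖ ^ 2 +
    ∑ i ∈ Finset.range (k + 1), err i ω) / stepSum a k) ∂P ≤ _
  rw [integral_add (integrable_const _) hdi, integral_const, integral_div, integral_add (integrable_const _) hsumi,
    integral_finsetSum _ fun i _ => (herr_int i).1, integral_const]
  simp only [probReal_univ, smul_eq_mul, one_mul]
  gcongr with i hi
  exact (herr_int i).2

/-! ### Step sizes -/

/-- Consecutive steps `s ≤ t` differ by at most `1/(2λ)`, so `λ (t² - s²) ≤ (t + s)/2 ≤ t`, the
increment of `A_k`. -/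
theorem isStepSize_min {lam c : ℝ} (hlam : 0 < lam) (hc : 0 < c) :
    IsStepSize (fun i : ℕ => min (((i : ℝ) + 1) / (2 * lam)) c) lam := by
  refine ⟨fun k => lt_min (by positivity) hc, fun k => ?_⟩
  induction k with
  | zero =>
    have h0 : 0 < min (((0 : ℕ) + 1 : ℝ) / (2 * lam)) c := lt_min (by positivity) hc
    have h1 : min (((0 : ℕ) + 1 : ℝ) / (2 * lam)) c ≤ ((0 : ℕ) + 1 : ℝ) / (2 * lam) :=
      min_le_left _ _
    simp only [stepSum, zero_add, Finset.sum_range_one]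
    rw [le_div_iff₀ (by positivity)] at h1
    push_cast at *
    nlinarith
  | succ k ih =>
    rw [stepSum_succ]
    set s := min (((k : ℝ) + 1) / (2 * lam)) c with hs
    set t := min ((((k + 1 : ℕ) : ℝ) + 1) / (2 * lam)) c with ht
    have hs0 : 0 < s := lt_min (by positivity) hc
    have hst : s ≤ t := min_le_min_right _ (by gcongr; linarith)
    have hts : t ≤ s + 1 / (2 * lam) := by
      have e : (((k + 1 : ℕ) : ℝ) + 1) / (2 * lam) = ((k : ℝ) + 1) / (2 * lam) + 1 / (2 * lam) := by
        push_cast; ring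
      have hp : 0 < 1 / (2 * lam) := by positivity
      rcases min_choice (((k : ℝ) + 1) / (2 * lam)) c with h | h
      · rw [hs, h, ← e]; exact min_le_left _ _
      · rw [hs, h]; exact (min_le_right _ _).trans (by linarith)
    have h2 : lam * (t - s) ≤ 1 / 2 := by
      have : lam * (1 / (2 * lam)) = 1 / 2 := by field_simp
      nlinarith
    have h3 : lam * t ^ 2 - lam * s ^ 2 ≤ t := by
      have e : lam * t ^ 2 - lam * s ^ 2 = lam * (t - s) * (t + s) := by ring
      rw [e]
      have : lam * (t - s) * (t + s) ≤ 1 / 2 * (t + s) := by gcongr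
      linarith
    linarith

/-- For `i ≤ k` the step `a_i` is at least `(i+1)/(k+1)` times `a_k`; sum over `i`. -/
theorem stepSum_min_ge {lam c : ℝ} (hlam : 0 < lam) (hc : 0 < c) (k : ℕ) :
    ((k : ℝ) + 1) / 2 * min (((k : ℝ) + 1) / (2 * lam)) c ≤
      stepSum (fun i : ℕ => min (((i : ℝ) + 1) / (2 * lam)) c) k := by
  set m := min (((k : ℝ) + 1) / (2 * lam)) c with hm
  have hm0 : 0 < m := lt_min (by positivity) hc
  have hk : (0 : ℝ) < (k : ℝ) + 1 := by positivity
  have hsum : ∀ n : ℕ, ∑ i ∈ Finset.range n, ((i : ℝ) + 1) = n * (n + 1) / 2 := fun n => by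
    induction n with
    | zero => simp
    | succ n ih => rw [Finset.sum_range_succ, ih]; push_cast; ring
  have h1 : ∑ i ∈ Finset.range (k + 1), ((i : ℝ) + 1) * (m / ((k : ℝ) + 1)) ≤
      stepSum (fun i : ℕ => min (((i : ℝ) + 1) / (2 * lam)) c) k := by
    refine Finset.sum_le_sum fun i hi => ?_
    have hik : (i : ℝ) + 1 ≤ (k : ℝ) + 1 := by
      have : i ≤ k := by have := Finset.mem_range.1 hi; omega
      have : (i : ℝ) ≤ k := by exact_mod_cast this
      linarith
    refine le_min ?_ ?_
    · calc ((i : ℝ) + 1) * (m / ((k : ℝ) + 1))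
          ≤ ((i : ℝ) + 1) * (((k : ℝ) + 1) / (2 * lam) / ((k : ℝ) + 1)) := by
            gcongr; exact min_le_left _ _
        _ = _ := by field_simp
    · calc ((i : ℝ) + 1) * (m / ((k : ℝ) + 1)) ≤ ((k : ℝ) + 1) * (m / ((k : ℝ) + 1)) := by gcongr
        _ = m := by field_simp
        _ ≤ c := min_le_right _ _
  refine le_trans ?_ h1
  rw [← Finset.sum_mul, hsum]
  push_cast
  have e : ((k : ℝ) + 1) * (k + 1 + 1) / 2 * (m / (k + 1)) = (k + 1 + 1) / 2 * m := by field_simp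
  rw [e]
  gcongr
  linarith

theorem exists_stepSize {lam V D ε : ℝ} (hlam : 0 ≤ lam) (hV : 0 ≤ V) (hD : 0 ≤ D) (hε : 0 < ε) :
    ∃ (a : ℕ → ℝ) (N : ℕ), IsStepSize a lam ∧
      (N : ℝ) ≤ 16 * (√(lam / ε) * D + V * D ^ 2 / ε ^ 2) ∧
      ∀ k, N ≤ k → (1 / 2 * D ^ 2 + ∑ i ∈ Finset.range (k + 1), a i ^ 2 * V) / stepSum a k ≤
        ε / 2 := by
  set p := 4 * (√(lam / ε) * D) with hp
  set q := 16 * (V * D ^ 2 / ε ^ 2) with hq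
  have hp0 : 0 ≤ p := by positivity
  have hq0 : 0 ≤ q := by positivity
  -- Floors avoid an additive constant in the bound on `N`; they suffice because `A_k` is bounded
  -- below in terms of `k + 1`.
  set N := ⌊p⌋₊ + ⌊q⌋₊ with hN
  have hNp : p ≤ N + 1 := by
    have h1 := (Nat.lt_floor_add_one p).le
    have h2 : (0 : ℝ) ≤ (⌊q⌋₊ : ℝ) := Nat.cast_nonneg _
    rw [hN]; push_cast; linarith
  have hNq : q ≤ N + 1 := by
    have h1 := (Nat.lt_floor_add_one q).le
    have h2 : (0 : ℝ) ≤ (⌊p⌋₊ : ℝ) := Nat.cast_nonneg _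
    rw [hN]; push_cast; linarith
  have hN1 : (1 : ℝ) ≤ N + 1 := by have : (0 : ℝ) ≤ N := Nat.cast_nonneg _
                                   linarith
  -- A small positive substitute is needed when `lam = 0`, because the steps divide by it. The same
  -- is done for `V = 0` in choosing the cap `c`, which otherwise is `ε/(4V)`, so that the noise
  -- contributes at most `ε / 4`.
  obtain ⟨lam', hlam', hle, hlN⟩ : ∃ lam' : ℝ, 0 < lam' ∧ lam ≤ lam' ∧
      16 * lam' * D ^ 2 ≤ ε * ((N : ℝ) + 1) ^ 2 := by
    rcases hlam.eq_or_lt with h0 | h0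
    · refine ⟨ε / (16 * D ^ 2 + 1), by positivity, by rw [← h0]; positivity, ?_⟩
      have h1 : 16 * (ε / (16 * D ^ 2 + 1)) * D ^ 2 ≤ ε := by
        have e : 16 * (ε / (16 * D ^ 2 + 1)) * D ^ 2 = ε * (16 * D ^ 2 / (16 * D ^ 2 + 1)) := by ring
        rw [e]
        exact mul_le_of_le_one_right hε.le ((div_le_one (by positivity)).2 (by linarith))
      exact h1.trans (le_mul_of_one_le_right hε.le (one_le_pow₀ hN1))
    · refine ⟨lam, h0, le_rfl, ?_⟩
      have h1 : p ^ 2 ≤ ((N : ℝ) + 1) ^ 2 := by gcongr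
      have h2 : p ^ 2 = 16 * (lam / ε) * D ^ 2 := by
        rw [hp, mul_pow, mul_pow, Real.sq_sqrt (by positivity)]; ring
      have h3 := mul_le_mul_of_nonneg_left h1 hε.le
      rw [h2] at h3
      refine le_trans (le_of_eq ?_) h3
      field_simp
  obtain ⟨c, hc, hcV, hcN⟩ : ∃ c : ℝ, 0 < c ∧ c * V ≤ ε / 4 ∧ 4 * D ^ 2 ≤ ε * c * ((N : ℝ) + 1) := by
    rcases hV.eq_or_lt with h0 | h0
    · refine ⟨4 * D ^ 2 / ε + 1, by positivity, by rw [← h0]; linarith, ?_⟩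
      have e : ε * (4 * D ^ 2 / ε + 1) = 4 * D ^ 2 + ε := by field_simp
      rw [e]
      exact le_trans (by linarith) (le_mul_of_one_le_right (by positivity) hN1)
    · refine ⟨ε / (4 * V), by positivity, by field_simp; rfl, ?_⟩
      have h1 := mul_le_mul_of_nonneg_left hNq (by positivity : 0 ≤ ε * (ε / (4 * V)))
      refine le_trans (le_of_eq ?_) h1
      rw [hq]; field_simp; ring
  set a : ℕ → ℝ := fun i => min (((i : ℝ) + 1) / (2 * lam')) c with ha
  have hstep : IsStepSize a lam' := isStepSize_min hlam' hc
  refine ⟨a, N, ⟨hstep.1, fun k => le_trans (by gcongr) (hstep.2 k)⟩, ?_, fun k hk => ?_⟩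
  · have h1 := Nat.floor_le hp0
    have h2 := Nat.floor_le hq0
    have h3 : 0 ≤ √(lam / ε) * D := by positivity
    rw [hN]; push_cast; linarith
  · have hA := stepSum_pos hstep.1 k
    have hkN : (N : ℝ) + 1 ≤ (k : ℝ) + 1 := by
      have : (N : ℝ) ≤ k := by exact_mod_cast hk
      linarith
    have hAge := stepSum_min_ge hlam' hc k
    have hDA : 1 / 2 * D ^ 2 ≤ ε / 4 * stepSum a k := by
      have h1 : 2 * D ^ 2 ≤ ε * (((k : ℝ) + 1) / 2 * min (((k : ℝ) + 1) / (2 * lam')) c) := by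
        rcases min_choice (((k : ℝ) + 1) / (2 * lam')) c with h | h
        · rw [h]
          have h2 : 16 * lam' * D ^ 2 ≤ ε * ((k : ℝ) + 1) ^ 2 := hlN.trans (by gcongr)
          have e : ε * (((k : ℝ) + 1) / 2 * (((k : ℝ) + 1) / (2 * lam'))) =
              ε * ((k : ℝ) + 1) ^ 2 / (4 * lam') := by field_simp; norm_num
          rw [e, le_div_iff₀ (by positivity)]
          nlinarith [mul_nonneg hlam'.le (sq_nonneg D)]
        · rw [h]
          have h2 : 4 * D ^ 2 ≤ ε * c * ((k : ℝ) + 1) := hcN.trans (by gcongr)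
          linarith
      have h3 := mul_le_mul_of_nonneg_left hAge hε.le
      linarith
    have hVA : ∑ i ∈ Finset.range (k + 1), a i ^ 2 * V ≤ ε / 4 * stepSum a k := by
      rw [stepSum, Finset.mul_sum]
      refine Finset.sum_le_sum fun i _ => ?_
      have h1 : a i ≤ c := min_le_right _ _
      have h0 := (hstep.1 i).le
      calc a i ^ 2 * V = a i * (a i * V) := by ring
        _ ≤ a i * (c * V) := by gcongr
        _ ≤ a i * (ε / 4) := by gcongr
        _ = _ := by ring
    rw [div_le_iff₀ hA]
    linarith

/-! ### Smoothness at the largest admissible radius -/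

/-- Each bound on `λ_r` contains `1 / r`, and `ε / 2 ≤ gap` turns each upper bound on the gap into
one on `1 / r`. In the polytope bound the factor `√d` from smoothness cancels the `1/√d` from
concentration. -/
theorem smoothness_le_of_isGreatest {d : ℕ} (hd : 0 < d) {f : E d → ℝ} {γ : E d → E d}
    {xs : E d} {ε r L Lhat : ℝ} (hγ : IsSubgradientSelection f γ) (hε : 0 < ε)
    (hr : IsGreatest (admissibleRadii f xs ε) r) (hm : IsBVGMax f γ r Lhat)
    (hav : IsBVGAvg f γ r L) :
    (smoothness f r : ℝ) ≤ 8 * (L ^ 2 * d / ε) ∧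
      (smoothness f r : ℝ) ≤ 9 * (L * Lhat * √d / ε) ∧
      ∀ (κ : ℝ) (K : Set (E d)), IsPolytope K → goldstein f r xs ⊆ K →
        Metric.diam K ≤ κ * Lhat →
        (smoothness f r : ℝ) ≤ 27 * (κ * (Lhat ^ 2 * √(Real.log (numVertices K)) / ε)) := by
  have hr0 := hr.1.1
  have hd0 : (0 : ℝ) < d := by exact_mod_cast hd
  have hLhat := hm.2.1
  have hL := hav.nonneg hr0
  have hgap := le_smoothed_sub_of_isGreatest hm.1.continuous hγ (hm.norm_le hr0) hr
  have hrL := hgap.trans (hav.smoothed_sub_le hd hm hr0 hγ xs)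
  have hrinv : 1 / r ≤ 2 * L / ε := by
    rw [div_le_div_iff₀ hr0 hε]; linarith
  refine ⟨?_, ?_, fun κ K hK hGK hdiam => ?_⟩
  · calc (smoothness f r : ℝ) ≤ 4 * d * L / r := hav.smoothness_le hd hm hr0 hγ
      _ = 4 * d * L * (1 / r) := by ring
      _ ≤ 4 * d * L * (2 * L / ε) := by gcongr
      _ = _ := by ring
  · calc (smoothness f r : ℝ) ≤ 9 / 2 * √d * Lhat / r := hm.smoothness_le hd hr0 hγ
      _ = 9 / 2 * √d * Lhat * (1 / r) := by ring
      _ ≤ 9 / 2 * √d * Lhat * (2 * L / ε) := by gcongr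
      _ = _ := by ring
  · have h1 := hgap.trans (smoothed_sub_le_of_polytope hd hm.1 hγ hr0 xs hK hGK)
    set ℓ := Real.log (numVertices K) with hℓ
    have h2 : √(2 * ℓ / d) = √2 * √ℓ / √d := by
      rw [mul_div_assoc, Real.sqrt_mul zero_le_two, Real.sqrt_div' _ hd0.le, mul_div_assoc]
    have hsq2 : √2 ≤ 3 / 2 := Real.sqrt_le_iff.2 ⟨by norm_num, by norm_num⟩
    have hκ : 0 ≤ κ * Lhat := Metric.diam_nonneg.trans hdiam
    have hsd : 0 < √(d : ℝ) := Real.sqrt_pos.2 hd0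
    have h3 : ε / 2 ≤ r * (2 * (κ * Lhat * (3 / 2 * √ℓ / √d))) := by
      refine h1.trans ?_
      rw [h2]
      gcongr
    have h4 : 1 / r ≤ 6 * (κ * Lhat) * √ℓ / √d / ε := by
      rw [div_le_div_iff₀ hr0 hε]
      have e : r * (2 * (κ * Lhat * (3 / 2 * √ℓ / √d))) =
        1 / 2 * (6 * (κ * Lhat) * √ℓ / √d * r) := by ring
      rw [e] at h3
      linarith
    calc (smoothness f r : ℝ) ≤ 9 / 2 * √d * Lhat / r := hm.smoothness_le hd hr0 hγ
      _ = 9 / 2 * √d * Lhat * (1 / r) := by ring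
      _ ≤ 9 / 2 * √d * Lhat * (6 * (κ * Lhat) * √ℓ / √d / ε) := by gcongr
      _ = _ := by field_simp; ring

end

/-! ### Assembly of the main theorem. -/

theorem mainTheorem1 :
    ∃ C : ℝ, 0 < C ∧
      ∀ (d : ℕ) (_ : 0 < d) (X : Set (E d)) (f : E d → ℝ) (γ : E d → E d)
        (xs x₀ : E d) (r₀ L₀ ε : ℝ),
        IsClosed X → Convex ℝ X → ConvexOn ℝ Set.univ f → IsSubgradientSelection f γ →
        xs ∈ X → IsMinOn f X xs → x₀ ∈ X →
        0 < r₀ → IsBVGMax f γ r₀ L₀ → 0 < ε →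
        -- a largest admissible radius exists, except in the degenerate case `λ_ρ = 0` for all `ρ`
        ((∃ r, IsGreatest (admissibleRadii f xs ε) r) ∨
          ∀ ρ : ℝ, 0 < ρ → ρ ∈ admissibleRadii f xs ε ∧ smoothness f ρ = 0) ∧
        ∀ r ∈ admissibleRadii f xs ε,
          -- `λ_r`, `L̂_r` and `L_r` are well defined and finite
          Differentiable ℝ (smoothed f r) ∧
          LipschitzWith (smoothness f r) (gradient (smoothed f r)) ∧
          (∃ Lhat, IsBVGMax f γ r Lhat) ∧ (∃ L, IsBVGAvg f γ r L) ∧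
          ∀ Lhat L : ℝ, IsBVGMax f γ r Lhat → IsBVGAvg f γ r L →
            -- convergence bound for arbitrary admissible step sizes
            (∀ (Ω : Type*) [MeasurableSpace Ω] (P : Measure Ω) [IsProbabilityMeasure P]
              (u : ℕ → Ω → E d) (a : ℕ → ℝ),
              IsUnifBallSample P u → IsStepSize a (smoothness f r) → ∀ k : ℕ,
                Integrable (fun ω => f (smoothedAGD X a γ r x₀ (fun i => u i ω) k)) P ∧
                ∫ ω, (f (smoothedAGD X a γ r x₀ (fun i => u i ω) k) - f xs) ∂P ≤
                  ε / 2 + (1 / 2 * ‖xs - x₀‖ ^ 2 +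
                    ∑ i ∈ Finset.range (k + 1), a i ^ 2 * (Lhat * L)) / stepSum a k) ∧
            -- iteration complexity
            (∃ (a : ℕ → ℝ) (N : ℕ), IsStepSize a (smoothness f r) ∧
              (N : ℝ) ≤ C * (√(smoothness f r / ε) * ‖xs - x₀‖ +
                Lhat * L * ‖xs - x₀‖ ^ 2 / ε ^ 2) ∧
              ∀ (Ω : Type*) [MeasurableSpace Ω] (P : Measure Ω) [IsProbabilityMeasure P]
                (u : ℕ → Ω → E d), IsUnifBallSample P u → ∀ k : ℕ, N ≤ k →
                  Integrable (fun ω => f (smoothedAGD X a γ r x₀ (fun i => u i ω) k)) P ∧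
                  ∫ ω, (f (smoothedAGD X a γ r x₀ (fun i => u i ω) k) - f xs) ∂P ≤ ε) ∧
            -- bound on `λ_r` for the largest admissible radius
            (IsGreatest (admissibleRadii f xs ε) r →
              (smoothness f r : ℝ) ≤ C * min (L ^ 2 * d / ε) (L * Lhat * √d / ε) ∧
              ∀ (κ : ℝ) (K : Set (E d)), IsPolytope K → goldstein f r xs ⊆ K →
                Metric.diam K ≤ κ * Lhat →
                (smoothness f r : ℝ) ≤
                  C * min (min (L ^ 2 * d / ε) (L * Lhat * √d / ε))
                    (κ * (Lhat ^ 2 * √(Real.log (numVertices K)) / ε))) := by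
  -- The largest of the constants `16` (complexity) and `8`, `9`, `27` (bounds on `λ_r`).
  refine ⟨27, by norm_num, ?_⟩
  intro d hd X f γ xs x₀ r₀ L₀ ε hX hXc hfc hγ hxs _ hx₀ hr₀ hm₀ hε
  refine ⟨exists_isGreatest_admissibleRadii hfc hm₀.1.continuous hγ (hm₀.norm_le hr₀) xs hε,
    fun r hr => ?_⟩
  have hr0 : 0 < r := hr.1
  obtain ⟨L', hm'⟩ := hm₀.exists_radius hr₀ hr0
  refine ⟨fun x => (hm'.hasGradientAt_smoothed hd hr0 hγ x).differentiableAt, ?_, ⟨L', hm'⟩,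
    hm'.exists_isBVGAvg hd hr0 hγ, fun Lhat L hm hav => ⟨?_, ?_, ?_⟩⟩
  · rw [hm'.gradient_smoothed hd hr0 hγ]
    exact hm'.lipschitzWith_gradient hd hr0 hγ
  · intro Ω _ P _ u a hu ha k
    exact smoothedAGD_convergence hd hX hXc hγ hxs hx₀ hr hm hav hu ha k
  · have hV : 0 ≤ Lhat * L := mul_nonneg hm.2.1.le (hav.nonneg hr0)
    obtain ⟨a, N, ha, hN, hk⟩ := exists_stepSize (smoothness f r).2 hV (norm_nonneg (xs - x₀)) hε
    refine ⟨a, N, ha, hN.trans ?_, fun Ω _ P _ u hu k hNk => ?_⟩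
    · have h1 : 0 ≤ √(smoothness f r / ε) * ‖xs - x₀‖ + Lhat * L * ‖xs - x₀‖ ^ 2 / ε ^ 2 := by
        positivity
      exact mul_le_mul_of_nonneg_right (by norm_num) h1
    · obtain ⟨h1, h2⟩ := smoothedAGD_convergence hd hX hXc hγ hxs hx₀ hr hm hav hu ha k
      exact ⟨h1, h2.trans (by linarith [hk k hNk])⟩
  · intro hg
    have hL := hav.nonneg hr0
    have hLhat := hm.2.1
    obtain ⟨h1, h2, h3⟩ := smoothness_le_of_isGreatest hd hγ hε hg hm hav
    have h12 : (smoothness f r : ℝ) ≤ 27 * min (L ^ 2 * d / ε) (L * Lhat * √d / ε) := by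
      rw [mul_min_of_nonneg _ _ (by norm_num)]
      refine le_min (h1.trans ?_) (h2.trans ?_)
      · exact mul_le_mul_of_nonneg_right (by norm_num) (by positivity)
      · exact mul_le_mul_of_nonneg_right (by norm_num) (by positivity)
    refine ⟨h12, fun κ K hK hGK hdiam => ?_⟩
    rw [mul_min_of_nonneg _ _ (by norm_num)]
    exact le_min h12 (h3 κ K hK hGK hdiam)
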